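/- A geometry $(G,I,O)$ is a finite simple graph $G$ with subsets $I,O\subseteq V(G)$; write $n=|V(G)|$, $m=|E(G)|$, $k=|O|$ and $v\sim w$ for adjacency. A successor function of $(G,I,O)$ is an injective function $f:V(G)\setminus O\to V(G)\setminus I$ whose maximal orbits form a path cover: they are directed paths in $G$, every vertex lies on exactly one of them, each meets $I$ at most in its initial point, and each meets $O$ exactly in its final point. The natural pre-order $\preceq$ of $f$ is the reflexive and transitive closure on $V(G)$ of the relation that holds for $(v,w)$ iff $v\notin O$, $v\ne w$, and $w=f(v)$ or $w\sim f(v)$. **Theorem.** There is an algorithm (for a random access machine on which addition, truncated subtraction, comparison of natural numbers and array access have unit cost) which, given any geometry $(G,I,O)$ with $V(G)=\{0,\dots,n-1\}$ (as $n$, adjacency lists of $G$ stored consecutively in one array together with the array of their starting positions, and lists of the elements of $I$ and of $O$ with their lengths) and any successor function $f$ of it (as an array), runs in time $O(k^2n)$ and also in time $O(k(m+n))$, with absolute constants (for the graph without vertices: in time $O(1)$), and * if $\preceq$ is not a partial order, reports this; * if $\preceq$ is a partial order, reports this and returns arrays $\mathrm{dist}:V(G)\to\mathbb N$, $\mathrm{path}:V(G)\to\{1,\dots,k\}$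 and $\inf:V(G)\times\{1,\dots,k\}\to\mathbb Z$ such that 1. $(\mathrm{dist},\mathrm{path})$ is a path-labelling of the orbits of $f$: $\mathrm{path}(v)=\mathrm{path}(w)$ iff $v$ and $w$ lie on the same maximal orbit of $f$, and $\mathrm{dist}(v)$ is the distance of $v$ from the initial point of its maximal orbit; 2. $(\mathrm{dist},\mathrm{path},\inf)$ is a system of infima for $\preceq$: for all $v,w\in V(G)$, $v\preceq w \iff \mathrm{dist}(v)\le\inf(w,\mathrm{path}(v))$; 3. for all $w\in V(G)$ and $p\in\{1,\dots,k\}$, $\inf(w,p)$ is the largest $\mathrm{dist}(v)$ over the vertices $v$ with $\mathrm{path}(v)=p$ and $v\preceq w$, and $-1$ if there is no such $v$. -/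

import Mathlib

/-! ### Geometries, path covers, successor functions -/

/-- A geometry `(G, I, O)`: a simple graph with a set of inputs and a set of outputs. -/
structure Geometry (V : Type) where
  graph : SimpleGraph V
  inputs : Finset V
  outputs : Finset V

namespace Geometry

variable {V : Type}

/-- Functions `f : Oᶜ → Iᶜ`. -/
abbrev Fn (Γ : Geometry V) : Type := {v : V // v ∉ Γ.outputs} → {v : V // v ∉ Γ.inputs}

/-- A collection `C` of (possibly trivial) directed paths of `G`, each given by its sequence of
vertices, is a path cover of `(G, I, O)`. -/
structure IsPathCover (Γ : Geometry V) (C : Set (List V)) : Prop where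
  ne_nil : ∀ p ∈ C, p ≠ []
  nodup : ∀ p ∈ C, p.Nodup
  isChain : ∀ p ∈ C, p.IsChain Γ.graph.Adj
  cover : ∀ v : V, ∃! p : List V, p ∈ C ∧ v ∈ p
  inputs_initial : ∀ p ∈ C, ∀ (i : ℕ) (hi : i < p.length), p[i] ∈ Γ.inputs → i = 0
  outputs_final : ∀ p ∈ C, ∀ (i : ℕ) (hi : i < p.length), p[i] ∈ Γ.outputs ↔ i + 1 = p.length

/-- `w = f(v)`, for vertices `v`, `w`; in particular `v` is in the domain of `f`. -/
def IsSucc {Γ : Geometry V} (f : Γ.Fn) (v w : V) : Prop :=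
  ∃ h : v ∉ Γ.outputs, (f ⟨v, h⟩ : V) = w

/-- The maximal orbits `v, f(v), f(f(v)), …` of `f`: finite nonempty sequences in which every entry
is followed by its image under `f`, which start outside of the image of `f` and end outside of the
domain of `f`. -/
def maximalOrbits {Γ : Geometry V} (f : Γ.Fn) : Set (List V) :=
  {p | p ≠ [] ∧ p.IsChain (IsSucc f) ∧ (∀ v ∈ p.head?, ∀ u, ¬ IsSucc f u v) ∧
    ∀ v ∈ p.getLast?, v ∈ Γ.outputs}

/-- `f` is a successor function: it is injective and its maximal orbits form a path cover. -/
def IsSuccessorFn {Γ : Geometry V} (f : Γ.Fn) : Prop :=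
  Function.Injective f ∧ Γ.IsPathCover (maximalOrbits f)

/-- The influence relation of `f`: `v ∈ Oᶜ`, `v ≠ w`, and either `w = f(v)` or `w ∼ f(v)`. -/
def Influences {Γ : Geometry V} (f : Γ.Fn) (v w : V) : Prop :=
  v ≠ w ∧ ∃ h : v ∉ Γ.outputs, w = (f ⟨v, h⟩ : V) ∨ Γ.graph.Adj w (f ⟨v, h⟩ : V)

/-- The natural pre-order of `f`: the reflexive and transitive closure of the influence relation. -/
def NaturalPreorder {Γ : Geometry V} (f : Γ.Fn) : V → V → Prop :=
  Relation.ReflTransGen (Influences f)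

/-- The number of edges of the graph. -/
noncomputable def numEdges (Γ : Geometry V) : ℕ := Γ.graph.edgeSet.ncard

/-- `(dist, path)` is a path-labelling of the orbits of `f`: `path` is constant on each maximal
orbit and distinct on distinct maximal orbits, and `dist v` is the distance of `v` from the initial
point of the orbit on which it lies. -/
def IsPathLabelling {Γ : Geometry V} (f : Γ.Fn) (dist path : V → ℕ) : Prop :=
  (∀ v w : V, path v = path w ↔ ∃ p ∈ maximalOrbits f, v ∈ p ∧ w ∈ p) ∧
  ∀ p ∈ maximalOrbits f, ∀ (i : ℕ) (hi : i < p.length), dist p[i] = i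

end Geometry

/-- `(dist, path, inf)` is a system of infima for the pre-order `r`. -/
def IsSystemOfInfima {V : Type} (r : V → V → Prop) (dist path : V → ℕ) (inf : V → ℕ → ℤ) : Prop :=
  ∀ v w : V, r v w ↔ (dist v : ℤ) ≤ inf w (path v)

/-- For every vertex `w` and every path label `p ∈ {1, …, k}`, the number `inf w p` is the largest
distance of a vertex `v` with path label `p` and `r v w`, and it is `-1` if there is none. -/
def IsPathInfima {V : Type} (k : ℕ) (r : V → V → Prop) (dist path : V → ℕ) (inf : V → ℕ → ℤ) :
    Prop :=
  ∀ (w : V) (p : ℕ), 1 ≤ p → p ≤ k →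
    IsGreatest {d : ℤ | ∃ v : V, path v = p ∧ r v w ∧ d = (dist v : ℤ)} (inf w p) ∨
    ((∀ v : V, path v = p → ¬ r v w) ∧ inf w p = -1)

/-! ### Random access machine with unit cost

Structured programs over registers and arrays of natural numbers. A program is a finite object, so
it uses a fixed finite number of registers and arrays. The only arithmetic is addition and
(truncated) subtraction; there is no multiplication. -/

namespace RAM

/-- A memory state: the contents of the registers and of the arrays. -/
structure State where
  reg : ℕ → ℕ
  arr : ℕ → ℕ → ℕ

/-- Expressions. `get a e` is the entry with index `e` of the array `a`. -/
inductive Expr where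
  | const (c : ℕ)
  | reg (x : ℕ)
  | get (a : ℕ) (e : Expr)
  | add (e₁ e₂ : Expr)
  | sub (e₁ e₂ : Expr)
  | lt (e₁ e₂ : Expr)
  | eq (e₁ e₂ : Expr)

/-- The value of an expression (tests evaluate to `1` if true and to `0` if false). -/
def Expr.eval (s : State) : Expr → ℕ
  | .const c => c
  | .reg x => s.reg x
  | .get a e => s.arr a (e.eval s)
  | .add e₁ e₂ => e₁.eval s + e₂.eval s
  | .sub e₁ e₂ => e₁.eval s - e₂.eval s
  | .lt e₁ e₂ => if e₁.eval s < e₂.eval s then 1 else 0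
  | .eq e₁ e₂ => if e₁.eval s = e₂.eval s then 1 else 0

/-- The time to evaluate an expression: one step for each operation, constant or access. -/
def Expr.cost : Expr → ℕ
  | .const _ => 1
  | .reg _ => 1
  | .get _ e => e.cost + 1
  | .add e₁ e₂ => e₁.cost + e₂.cost + 1
  | .sub e₁ e₂ => e₁.cost + e₂.cost + 1
  | .lt e₁ e₂ => e₁.cost + e₂.cost + 1
  | .eq e₁ e₂ => e₁.cost + e₂.cost + 1

/-- Programs. -/
inductive Prog where
  | skip
  | setReg (x : ℕ) (e : Expr)
  | setArr (a : ℕ) (i e : Expr)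
  | seq (p q : Prog)
  | ite (e : Expr) (p q : Prog)
  | loop (e : Expr) (p : Prog)

/-- Overwrite the register `x`. -/
def State.setReg (s : State) (x v : ℕ) : State :=
  { s with reg := Function.update s.reg x v }

/-- Overwrite the entry with index `i` of the array `a`. -/
def State.setArr (s : State) (a i v : ℕ) : State :=
  { s with arr := Function.update s.arr a (Function.update (s.arr a) i v) }

/-- `Exec p s t s'`: the program `p`, started in the state `s`, terminates after `t` steps in the
state `s'`. Tests succeed when they evaluate to a nonzero number; `loop e p` repeats `p` while `e`
succeeds. -/
inductive Exec : Prog → State → ℕ → State → Prop where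
  | skip (s : State) : Exec .skip s 1 s
  | setReg (x : ℕ) (e : Expr) (s : State) :
      Exec (.setReg x e) s (e.cost + 1) (s.setReg x (e.eval s))
  | setArr (a : ℕ) (i e : Expr) (s : State) :
      Exec (.setArr a i e) s (i.cost + e.cost + 1) (s.setArr a (i.eval s) (e.eval s))
  | seq {p q : Prog} {s₁ s₂ s₃ : State} {t₁ t₂ : ℕ} :
      Exec p s₁ t₁ s₂ → Exec q s₂ t₂ s₃ → Exec (.seq p q) s₁ (t₁ + t₂) s₃
  | ite_true {e : Expr} {p q : Prog} {s₁ s₂ : State} {t : ℕ} :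
      e.eval s₁ ≠ 0 → Exec p s₁ t s₂ → Exec (.ite e p q) s₁ (e.cost + 1 + t) s₂
  | ite_false {e : Expr} {p q : Prog} {s₁ s₂ : State} {t : ℕ} :
      e.eval s₁ = 0 → Exec q s₁ t s₂ → Exec (.ite e p q) s₁ (e.cost + 1 + t) s₂
  | loop_true {e : Expr} {p : Prog} {s₁ s₂ s₃ : State} {t₁ t₂ : ℕ} :
      e.eval s₁ ≠ 0 → Exec p s₁ t₁ s₂ → Exec (.loop e p) s₂ t₂ s₃ →
      Exec (.loop e p) s₁ (e.cost + 1 + t₁ + t₂) s₃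
  | loop_false {e : Expr} {p : Prog} {s : State} :
      e.eval s = 0 → Exec (.loop e p) s (e.cost + 1) s

/-- The state `s` holds the input `(G, I, O)`, `f`, where `V(G) = {0, …, n - 1}`.
Registers `0`, `1`, `2` hold `n`, `|I|` and `|O|`. Arrays `0` and `1` hold adjacency lists: the
neighbours of `v` are listed, in any order, in the entries of array `1` with indices from
`arr 0 v` up to and excluding `arr 0 (v + 1)`. Arrays `2` and `3` list the elements of `I` and
of `O`, in any order. Array `4` holds `f` as a partial function on `V(G)`: its entry is `f(v) + 1`
for `v ∉ O`, and `0` (undefined) for `v ∈ O`. All other contents of the memory are arbitrary. -/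
structure HoldsInput {n : ℕ} (s : State) (Γ : Geometry (Fin n)) (f : Γ.Fn) : Prop where
  numVertices : s.reg 0 = n
  numInputs : s.reg 1 = Γ.inputs.card
  numOutputs : s.reg 2 = Γ.outputs.card
  offset_zero : s.arr 0 0 = 0
  offset_le : ∀ v : Fin n, s.arr 0 v ≤ s.arr 0 (v + 1)
  neighbours : ∀ v : Fin n, Set.BijOn (s.arr 1) (Set.Ico (s.arr 0 v) (s.arr 0 (v + 1)))
    {x : ℕ | ∃ w : Fin n, Γ.graph.Adj v w ∧ x = w}
  inputs : Set.BijOn (s.arr 2) (Set.Iio Γ.inputs.card) {x : ℕ | ∃ w ∈ Γ.inputs, x = w}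
  outputs : Set.BijOn (s.arr 3) (Set.Iio Γ.outputs.card) {x : ℕ | ∃ w ∈ Γ.outputs, x = w}
  succ_some : ∀ (v : Fin n) (h : v ∉ Γ.outputs), s.arr 4 v = ((f ⟨v, h⟩ : Fin n) : ℕ) + 1
  succ_none : ∀ v ∈ Γ.outputs, s.arr 4 (v : Fin n) = 0

/-- The array of distances that is returned in the state `s`. -/
def outDist {n : ℕ} (s : State) (v : Fin n) : ℕ := s.arr 5 v

/-- The array of path labels that is returned in the state `s`. -/
def outPath {n : ℕ} (s : State) (v : Fin n) : ℕ := s.arr 6 v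

/-- The `n × k` array of path infima that is returned in the state `s`, with columns numbered
`1, …, k`; its entries are integers `≥ -1` and are stored row by row, increased by one. -/
def outInf {n : ℕ} (k : ℕ) (s : State) (w : Fin n) (p : ℕ) : ℤ :=
  (s.arr 7 (w * k + p) : ℤ) - 1

end RAM

/-!
The algorithm is a topological sort of the influence relation that carries path infima along.

A vertex `a` *releases* the vertices `w` of its closed neighbourhood other than its predecessor under
`f` (`Geometry.Releases`). The influences `u → w` are exactly the pairs `(f u, w)` such that `f u`
releases `w`. A vertex is *ready* when everything that releases it has done so; then its successor
is *released*, that is, put into a queue of vertices that are still to release their neighbourhoods.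
The initial points of the orbits are in the queue from the start. The ready vertices are closed
under `≼`-predecessors and contain no cycle (`Geometry.IsSearch.insert`). So if all vertices get
released, then all get ready and `≼` is antisymmetric. Conversely, if `≼` is antisymmetric and not
all vertices are ready in the end, then a minimal vertex that is not ready still waits for some
`f u`, where `u ≼ w` is not ready either (`Geometry.IsSuccessorFn.ready_of_isPartialOrder`).

When `a` releases `w`, the row of `w` in the array of path infima is replaced by its maximum with
the row of the predecessor of `a`, which is ready and hence has its final row. Initial points have
a virtual predecessor with a row of zeros. When `w` gets ready, its own distance is entered. Since
`v ≼ w` holds for `v` before `w` on an orbit, these maxima are a system of infima.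

Each pair costs time `O(k)`, which gives `O(k(m + n))` in total. For the bound `O(k²n)`, note that
if `≼` is antisymmetric, then of the end points of an edge one is the last neighbour of the other
on its orbit (`Geometry.IsOrderedLabelling.maximal_neighbour`), whence `m ≤ kn`. The number `2m` is
the last starting position in the input, so that graphs with more edges are rejected in time `O(n)`.

Running times are proved in a Hoare logic with time bounds (`RAM.Runs`).
-/

namespace Geometry

/-! ### Coordinates on the orbits of a successor function -/

section Orbits

variable {V : Type} {Γ : Geometry V} {f : Γ.Fn} {u v w a b : V}

/-- `v` is not in the image of `f`, that is, `v` is the initial point of its maximal orbit. -/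
def IsInitial (f : Γ.Fn) (v : V) : Prop := ∀ u, ¬ IsSucc f u v

theorem isInitial_or_exists_isSucc (f : Γ.Fn) (a : V) : IsInitial f a ∨ ∃ u, IsSucc f u a := by
  rw [or_iff_not_imp_left]
  intro h
  simpa [IsInitial] using h

theorem IsSucc.right_unique (h : IsSucc f v a) (h' : IsSucc f v b) : a = b := by
  obtain ⟨_, rfl⟩ := h
  obtain ⟨_, rfl⟩ := h'
  rfl

theorem IsSuccessorFn.left_unique (hf : IsSuccessorFn f) (h : IsSucc f u a)
    (h' : IsSucc f v a) : u = v := by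
  obtain ⟨hu, rfl⟩ := h
  obtain ⟨hv, h⟩ := h'
  exact congrArg Subtype.val (hf.1 (Subtype.ext h)).symm

theorem exists_isSucc_of_not_mem_outputs (f : Γ.Fn) (h : v ∉ Γ.outputs) : ∃ a, IsSucc f v a :=
  ⟨_, h, rfl⟩

theorem isSucc_getElem {p : List V} (hp : p ∈ maximalOrbits f) (i : ℕ) (hi : i + 1 < p.length) :
    IsSucc f p[i] p[i + 1] :=
  List.isChain_iff_getElem.1 hp.2.1 i hi

theorem isInitial_getElem_zero {p : List V} (hp : p ∈ maximalOrbits f) (h : 0 < p.length) :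
    IsInitial f p[0] := by
  apply hp.2.2.1
  cases p with
  | nil => simp at h
  | cons x l => simp

theorem IsSuccessorFn.exists_getElem (hf : IsSuccessorFn f) (v : V) :
    ∃ p ∈ maximalOrbits f, ∃ (i : ℕ) (hi : i < p.length), p[i] = v := by
  obtain ⟨p, ⟨hp, hv⟩, -⟩ := hf.2.cover v
  obtain ⟨i, hi, h⟩ := List.mem_iff_getElem.1 hv
  exact ⟨p, hp, i, hi, h⟩

theorem IsSuccessorFn.orbit_unique (hf : IsSuccessorFn f) {p q : List V}
    (hp : p ∈ maximalOrbits f) (hq : q ∈ maximalOrbits f) (h : v ∈ p) (h' : v ∈ q) : p = q :=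
  (hf.2.cover v).unique ⟨hp, h⟩ ⟨hq, h'⟩

theorem IsSuccessorFn.exists_getElem_of_isSucc (hf : IsSuccessorFn f) (h : IsSucc f v a) :
    ∃ p ∈ maximalOrbits f, ∃ (i : ℕ) (hi : i + 1 < p.length), p[i] = v ∧ p[i + 1] = a := by
  obtain ⟨p, hp, i, hi, rfl⟩ := hf.exists_getElem v
  have hne : i + 1 ≠ p.length := fun h' => h.1 ((hf.2.outputs_final p hp i hi).2 h')
  have hi' : i + 1 < p.length := by omega
  exact ⟨p, hp, i, hi', rfl, (isSucc_getElem hp i hi').right_unique h⟩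

theorem IsSuccessorFn.adj (hf : IsSuccessorFn f) (h : IsSucc f v a) : Γ.graph.Adj v a := by
  obtain ⟨p, hp, i, hi, rfl, rfl⟩ := hf.exists_getElem_of_isSucc h
  exact List.isChain_iff_getElem.1 (hf.2.isChain p hp) i hi

theorem IsSuccessorFn.naturalPreorder_of_isSucc (hf : IsSuccessorFn f) (h : IsSucc f v a) :
    NaturalPreorder f v a :=
  .single ⟨(hf.adj h).ne, h.1, .inl h.2.symm⟩

theorem IsSuccessorFn.naturalPreorder_getElem (hf : IsSuccessorFn f) {p : List V}
    (hp : p ∈ maximalOrbits f) {i j : ℕ} (hij : i ≤ j) (hj : j < p.length) :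
    NaturalPreorder f p[i] p[j] := by
  induction j, hij using Nat.le_induction with
  | base => exact .refl
  | succ j hij ih =>
    exact (ih (by omega)).trans (hf.naturalPreorder_of_isSucc (isSucc_getElem hp j hj))

/-- Every vertex has a distance `d` from, and shares its orbit with, an initial point `r`. -/
theorem IsSuccessorFn.exists_dist_root (hf : IsSuccessorFn f) :
    ∃ (d : V → ℕ) (r : V → V), ∀ p ∈ maximalOrbits f, ∀ (i : ℕ) (hi : i < p.length),
      d p[i] = i ∧ r p[i] = p[0] := by
  have h : ∀ v, ∃ x : ℕ × V, ∀ p ∈ maximalOrbits f, ∀ (i : ℕ) (hi : i < p.length), p[i] = v →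
      x.1 = i ∧ x.2 = p[0] := by
    intro v
    obtain ⟨p, hp, i, hi, rfl⟩ := hf.exists_getElem v
    refine ⟨(i, p[0]), fun q hq j hj h => ?_⟩
    obtain rfl := hf.orbit_unique hq hp (h ▸ List.getElem_mem hj) (List.getElem_mem hi)
    exact ⟨((hf.2.nodup q hq).getElem_inj_iff.1 h).symm, rfl⟩
  choose x hx using h
  exact ⟨fun v => (x v).1, fun v => (x v).2, fun p hp i hi => hx _ p hp i hi rfl⟩

end Orbits

/-- `(d, L)` is the path-labelling of the orbits of `f` with labels `1, …, k` in which the orbits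
are numbered in the order of their initial points. -/
structure IsOrderedLabelling {n : ℕ} {Γ : Geometry (Fin n)} (f : Γ.Fn) (k : ℕ)
    (d L : Fin n → ℕ) : Prop where
  isPathLabelling : IsPathLabelling f d L
  pos : ∀ v, 1 ≤ L v
  le : ∀ v, L v ≤ k
  dist_succ : ∀ {v a}, IsSucc f v a → d a = d v + 1
  label_succ : ∀ {v a}, IsSucc f v a → L a = L v
  dist_initial : ∀ {v}, IsInitial f v → d v = 0
  label_initial : ∀ {v}, IsInitial f v → L v = {u | IsInitial f u ∧ u ≤ v}.ncard

section Labelling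

variable {n k : ℕ} {Γ : Geometry (Fin n)} {f : Γ.Fn} {d L : Fin n → ℕ} {v w : Fin n}

/-- An injective function has as many points outside of its image as outside of its domain. -/
theorem IsSuccessorFn.ncard_isInitial (hf : IsSuccessorFn f) :
    {v | IsInitial f v}.ncard = Γ.outputs.card := by
  classical
  have h1 : {v | IsInitial f v} = (Set.range fun x => (f x : Fin n))ᶜ := by
    ext v
    simp only [IsInitial, IsSucc, Set.mem_ofPred_eq, Set.mem_compl_iff, Set.mem_range,
      Subtype.exists, not_exists]
  have h2 : (Set.range fun x => (f x : Fin n)).ncard = n - Γ.outputs.card := by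
    have hinj : Function.Injective fun x => (f x : Fin n) := Subtype.val_injective.comp hf.1
    rw [← Set.image_univ, Set.ncard_image_of_injective _ hinj, Set.ncard_univ,
      Nat.card_eq_fintype_card, Fintype.card_subtype_compl]
    simp
  have h3 := Set.ncard_add_ncard_compl (Set.range fun x => (f x : Fin n))
  have h4 : Γ.outputs.card ≤ n := by simpa using Γ.outputs.card_le_univ
  rw [Nat.card_eq_fintype_card, Fintype.card_fin] at h3
  rw [h1]
  omega

theorem IsSuccessorFn.exists_isOrderedLabelling (hf : IsSuccessorFn f) :
    ∃ d L : Fin n → ℕ, IsOrderedLabelling f Γ.outputs.card d L := by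
  obtain ⟨d, r, hdr⟩ := hf.exists_dist_root
  have hr : ∀ v, IsInitial f (r v) := by
    intro v
    obtain ⟨p, hp, i, hi, rfl⟩ := hf.exists_getElem v
    rw [(hdr p hp i hi).2]
    exact isInitial_getElem_zero hp _
  have hinit : ∀ v, IsInitial f v → d v = 0 ∧ r v = v := by
    intro v hv
    obtain ⟨p, hp, i, hi, rfl⟩ := hf.exists_getElem v
    cases i with
    | zero => exact hdr p hp 0 hi
    | succ i => exact absurd (isSucc_getElem hp i hi) (hv _)
  -- The label of an orbit is the number of initial points up to its own one.
  set N : Fin n → Set (Fin n) := fun v => {u | IsInitial f u ∧ u ≤ v} with hN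
  have hmono : ∀ u v, IsInitial f u → IsInitial f v → (N u).ncard = (N v).ncard → u ≤ v := by
    intro u v hu hv huv
    by_contra hlt
    refine (Set.ncard_lt_ncard (s := N v) (t := N u) ?_ (Set.toFinite _)).ne huv.symm
    refine ⟨fun x hx => ⟨hx.1, hx.2.trans (not_le.1 hlt).le⟩, fun h => hlt ?_⟩
    exact (h (show u ∈ N u from ⟨hu, le_rfl⟩)).2
  refine ⟨d, fun v => (N (r v)).ncard, ⟨fun v w => ?_, fun p hp i hi => (hdr p hp i hi).1⟩,
    fun v => ?_, fun v => ?_, ?_, ?_, fun hv => (hinit _ hv).1, fun hv => ?_⟩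
  · constructor
    · intro h
      have hrr : r v = r w := le_antisymm (hmono _ _ (hr v) (hr w) h) (hmono _ _ (hr w) (hr v) h.symm)
      obtain ⟨p, hp, i, hi, rfl⟩ := hf.exists_getElem v
      obtain ⟨q, hq, j, hj, rfl⟩ := hf.exists_getElem w
      rw [(hdr p hp i hi).2, (hdr q hq j hj).2] at hrr
      have h0 : p[0] ∈ q := hrr ▸ List.getElem_mem _
      obtain rfl := hf.orbit_unique hp hq (List.getElem_mem _) h0
      exact ⟨p, hp, List.getElem_mem hi, List.getElem_mem hj⟩
    · rintro ⟨p, hp, hv, hw⟩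
      obtain ⟨i, hi, rfl⟩ := List.mem_iff_getElem.1 hv
      obtain ⟨j, hj, rfl⟩ := List.mem_iff_getElem.1 hw
      simp only [(hdr p hp i hi).2, (hdr p hp j hj).2]
  · exact (Set.ncard_pos (Set.toFinite _)).2 ⟨r v, hr v, le_rfl⟩
  · rw [← hf.ncard_isInitial]
    exact Set.ncard_le_ncard (fun x hx => hx.1) (Set.toFinite _)
  · intro v a h
    obtain ⟨p, hp, i, hi, rfl, rfl⟩ := hf.exists_getElem_of_isSucc h
    rw [(hdr p hp i _).1, (hdr p hp (i + 1) hi).1]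
  · intro v a h
    obtain ⟨p, hp, i, hi, rfl, rfl⟩ := hf.exists_getElem_of_isSucc h
    simp only [(hdr p hp i (by omega)).2, (hdr p hp (i + 1) hi).2]
  · rw [(hinit _ hv).2]

theorem IsOrderedLabelling.naturalPreorder (h : IsOrderedLabelling f k d L)
    (hf : IsSuccessorFn f) (hL : L v = L w) (hd : d v ≤ d w) : NaturalPreorder f v w := by
  obtain ⟨p, hp, hv, hw⟩ := (h.isPathLabelling.1 v w).1 hL
  obtain ⟨i, hi, rfl⟩ := List.mem_iff_getElem.1 hv
  obtain ⟨j, hj, rfl⟩ := List.mem_iff_getElem.1 hw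
  rw [h.isPathLabelling.2 p hp i hi, h.isPathLabelling.2 p hp j hj] at hd
  exact hf.naturalPreorder_getElem hp hd hj

theorem IsOrderedLabelling.ext (h : IsOrderedLabelling f k d L)
    (hL : L v = L w) (hd : d v = d w) : v = w := by
  obtain ⟨p, hp, hv, hw⟩ := (h.isPathLabelling.1 v w).1 hL
  obtain ⟨i, hi, rfl⟩ := List.mem_iff_getElem.1 hv
  obtain ⟨j, hj, rfl⟩ := List.mem_iff_getElem.1 hw
  rw [h.isPathLabelling.2 p hp i hi, h.isPathLabelling.2 p hp j hj] at hd
  subst hd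
  rfl

end Labelling

/-! ### A geometry with an antisymmetric natural pre-order has few edges -/

section EdgeBound

open scoped Classical

variable {n k : ℕ} {Γ : Geometry (Fin n)} {f : Γ.Fn} {d L : Fin n → ℕ}

/-- A vertex that does not come first on its orbit has a predecessor, and `≼` follows the orbit. -/
theorem IsOrderedLabelling.exists_pred_of_lt (h : IsOrderedLabelling f k d L)
    (hf : IsSuccessorFn f) {v w : Fin n} (hL : L v = L w) (hd : d v < d w) :
    ∃ u, IsSucc f u w ∧ NaturalPreorder f v u := by
  obtain ⟨u, hu⟩ := (isInitial_or_exists_isSucc f w).resolve_left fun hw => by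
    rw [h.dist_initial hw] at hd
    omega
  refine ⟨u, hu, h.naturalPreorder hf (hL.trans (h.label_succ hu)) ?_⟩
  have := h.dist_succ hu
  omega

/-- If `w` had a neighbour beyond `v` on the orbit of `v`, and `v` a neighbour beyond `w` on the
orbit of `w`, then `v ≼ w ≼ v`. -/
theorem IsOrderedLabelling.maximal_neighbour (h : IsOrderedLabelling f k d L)
    (hf : IsSuccessorFn f) (hpo : IsPartialOrder (Fin n) (NaturalPreorder f)) {v w : Fin n}
    (hvw : Γ.graph.Adj v w) :
    (∀ x, Γ.graph.Adj v x → L x = L w → d x ≤ d w) ∨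
      ∀ x, Γ.graph.Adj w x → L x = L v → d x ≤ d v := by
  have key : ∀ {v w x : Fin n}, Γ.graph.Adj w x → L x = L v → d v < d x →
      NaturalPreorder f v w := by
    intro v w x hwx hL hd
    obtain ⟨u, hu, hvu⟩ := h.exists_pred_of_lt hf hL.symm hd
    refine hvu.trans ?_
    by_cases huw : u = w
    · exact huw ▸ .refl
    · obtain ⟨hu, rfl⟩ := hu
      exact .single ⟨huw, hu, .inr hwx⟩
  by_contra! hcon
  obtain ⟨⟨x, hx, hxL, hxd⟩, y, hy, hyL, hyd⟩ := hcon
  exact hvw.ne (hpo.antisymm _ _ (key hy hyL hyd) (key hx hxL hxd))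

/-- For each edge `vw`, one of the end points is the last neighbour of the other one on its orbit;
there are at most `n * k` pairs of a vertex and its last neighbour on an orbit. -/
theorem IsOrderedLabelling.sum_degree_le (h : IsOrderedLabelling f k d L)
    (hf : IsSuccessorFn f) (hpo : IsPartialOrder (Fin n) (NaturalPreorder f)) :
    ∑ v, Γ.graph.degree v ≤ n * k + n * k := by
  set D : Finset (Fin n × Fin n) := {x | Γ.graph.Adj x.1 x.2} with hD
  have hcard : ∑ v, Γ.graph.degree v = D.card := by
    rw [hD, Finset.card_filter, Fintype.sum_prod_type]
    refine Finset.sum_congr rfl fun v _ => ?_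
    rw [← Finset.card_filter, ← SimpleGraph.card_neighborFinset_eq_degree]
    congr 1
    ext w
    simp
  set M : Finset (Fin n × Fin n) :=
    {x | Γ.graph.Adj x.1 x.2 ∧ ∀ y, Γ.graph.Adj x.1 y → L y = L x.2 → d y ≤ d x.2} with hM
  have hsub : D ⊆ M ∪ M.image Prod.swap := by
    rintro ⟨v, w⟩ hvw
    simp only [hD, Finset.mem_filter, Finset.mem_univ, true_and] at hvw
    simp only [hM, Finset.mem_union, Finset.mem_image, Finset.mem_filter, Finset.mem_univ,
      true_and, Prod.exists, Prod.swap_prod_mk, Prod.mk.injEq]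
    rcases h.maximal_neighbour hf hpo hvw with h' | h'
    · exact .inl ⟨hvw, h'⟩
    · exact .inr ⟨w, v, ⟨hvw.symm, h'⟩, rfl, rfl⟩
  have hMcard : M.card ≤ n * k := by
    have := Finset.card_le_card_of_injOn (s := M)
      (t := (Finset.univ : Finset (Fin n)) ×ˢ Finset.Icc 1 k) (fun x => (x.1, L x.2))
      (fun x _ => by simp [h.pos, h.le]) (by
        rintro ⟨v, w⟩ h1 ⟨v', w'⟩ h2 he
        simp only [hM, Finset.coe_filter, Finset.mem_univ, true_and, Set.mem_ofPred_eq] at h1 h2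
        simp only [Prod.mk.injEq] at he
        obtain ⟨rfl, he⟩ := he
        rw [h.ext he (le_antisymm (h2.2 _ h1.1 he) (h1.2 _ h2.1 he.symm))])
    simpa using this
  calc ∑ v, Γ.graph.degree v = D.card := hcard
    _ ≤ (M ∪ M.image Prod.swap).card := Finset.card_le_card hsub
    _ ≤ M.card + (M.image Prod.swap).card := Finset.card_union_le _ _
    _ ≤ M.card + M.card := Nat.add_le_add_left Finset.card_image_le _
    _ ≤ _ := by omega

theorem sum_degree_eq (Γ : Geometry (Fin n)) :
    ∑ v, Γ.graph.degree v = 2 * Γ.numEdges := by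
  rw [SimpleGraph.sum_degrees_eq_twice_card_edges, numEdges, Set.ncard_eq_toFinset_card',
    SimpleGraph.edgeFinset]

end EdgeBound

/-! ### The search through the released vertices -/

section Search

variable {V : Type} {Γ : Geometry V} {f : Γ.Fn} {A : Set (V × V)} {u v w x a : V}

/-- `w` is released by `a`: it lies in the closed neighbourhood of `a`, and `a` is not its
successor. The pairs with `a = f u` are the influences `u → w`. -/
def Releases (f : Γ.Fn) (a w : V) : Prop :=
  (w = a ∨ Γ.graph.Adj a w) ∧ ¬ IsSucc f w a

/-- The vertices which have been released by everything that releases them, when `A` is the set of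
the pairs treated so far. -/
def Ready (f : Γ.Fn) (A : Set (V × V)) : Set V := {w | ∀ a, Releases f a w → (a, w) ∈ A}

/-- The initial points and the successors of the ready vertices. -/
def Released (f : Γ.Fn) (A : Set (V × V)) : Set V := {a | ∀ u, IsSucc f u a → u ∈ Ready f A}

/-- The number of pairs with second entry `w` that have not been treated. -/
noncomputable def pending (f : Γ.Fn) (A : Set (V × V)) (w : V) : ℕ :=
  {a | Releases f a w ∧ (a, w) ∉ A}.ncard

/-- What is known of the natural pre-order below `w` when the pairs in `A` have been treated. -/
def Below (f : Γ.Fn) (A : Set (V × V)) (v w : V) : Prop :=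
  (v = w ∧ w ∈ Ready f A) ∨ ∃ a u, IsSucc f u a ∧ (a, w) ∈ A ∧ NaturalPreorder f v u

/-- `A` is a set of pairs that a search can have treated, without a cycle among the vertices which
are ready. -/
structure IsSearch (f : Γ.Fn) (A : Set (V × V)) : Prop where
  releases : ∀ {a w}, (a, w) ∈ A → Releases f a w
  released : ∀ {a w}, (a, w) ∈ A → a ∈ Released f A
  antisymm : ∀ {v w}, v ∈ Ready f A → w ∈ Ready f A → NaturalPreorder f v w →
    NaturalPreorder f w v → v = w

theorem IsSuccessorFn.releases_self (hf : IsSuccessorFn f) (v : V) : Releases f v v :=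
  ⟨.inl rfl, fun h => (hf.adj h).ne rfl⟩

theorem IsSuccessorFn.influences_iff (hf : IsSuccessorFn f) :
    Influences f u w ↔ ∃ a, IsSucc f u a ∧ Releases f a w := by
  constructor
  · rintro ⟨hne, hu, h⟩
    exact ⟨_, ⟨hu, rfl⟩, h.imp id fun h => h.symm, fun h' => hne (hf.left_unique ⟨hu, rfl⟩ h')⟩
  · rintro ⟨a, ⟨hu, rfl⟩, h, hn⟩
    exact ⟨fun h' => hn ⟨h' ▸ hu, by subst h'; rfl⟩, hu, h.imp id fun h => h.symm⟩

theorem Ready.mono {B : Set (V × V)} (h : A ⊆ B) : Ready f A ⊆ Ready f B :=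
  fun _ hw a ha => h (hw a ha)

theorem Released.mono {B : Set (V × V)} (h : A ⊆ B) : Released f A ⊆ Released f B :=
  fun _ ha u hu => Ready.mono h (ha u hu)

theorem IsSuccessorFn.ready_empty (hf : IsSuccessorFn f) : Ready f (∅ : Set (V × V)) = ∅ :=
  Set.eq_empty_of_forall_notMem fun w hw => hw w (hf.releases_self w)

theorem IsSuccessorFn.released_empty (hf : IsSuccessorFn f) :
    Released f (∅ : Set (V × V)) = {v | IsInitial f v} := by
  simp [Released, hf.ready_empty, IsInitial]

theorem IsSuccessorFn.isSearch_empty (hf : IsSuccessorFn f) : IsSearch f (∅ : Set (V × V)) where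
  releases h := h.elim
  released h := h.elim
  antisymm h := by simp [hf.ready_empty] at h

theorem IsSearch.ready_of_influences (hA : IsSearch f A) (hf : IsSuccessorFn f)
    (hw : w ∈ Ready f A) (h : Influences f u w) : u ∈ Ready f A := by
  obtain ⟨a, hu, ha⟩ := hf.influences_iff.1 h
  exact hA.released (hw a ha) u hu

theorem IsSearch.ready_of_naturalPreorder (hA : IsSearch f A) (hf : IsSuccessorFn f)
    (hw : w ∈ Ready f A) (h : NaturalPreorder f v w) : v ∈ Ready f A := by
  induction h with
  | refl => exact hw
  | tail _ h ih => exact ih (hA.ready_of_influences hf hw h)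

theorem mem_ready_insert :
    x ∈ Ready f (insert (a, w) A) ↔
      x ∈ Ready f A ∨ (x = w ∧ w ∈ Ready f (insert (a, w) A)) := by
  constructor
  · intro h
    by_cases hx : x = w
    · exact .inr ⟨hx, hx ▸ h⟩
    · exact .inl fun b hb => (h b hb).resolve_left fun h' => hx (Prod.mk.inj h').2
  · rintro (h | ⟨rfl, h⟩)
    · exact Ready.mono (Set.subset_insert _ _) h
    · exact h

/-- No cycle arises when `w` becomes ready: the ready vertices are closed under `≼`-predecessors, so
`w` lies below none of those that were ready before. -/
theorem IsSearch.insert (hA : IsSearch f A) (hf : IsSuccessorFn f) (haw : Releases f a w)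
    (ha : a ∈ Released f A) : IsSearch f (insert (a, w) A) where
  releases := by
    rintro b x (h | h)
    · obtain ⟨rfl, rfl⟩ := Prod.mk.inj h
      exact haw
    · exact hA.releases h
  released := by
    rintro b x (h | h)
    · obtain ⟨rfl, rfl⟩ := Prod.mk.inj h
      exact Released.mono (Set.subset_insert _ _) ha
    · exact Released.mono (Set.subset_insert _ _) (hA.released h)
  antisymm := by
    intro x y hx hy hxy hyx
    rcases mem_ready_insert.1 hx with h1 | ⟨rfl, -⟩
    · exact hA.antisymm h1 (hA.ready_of_naturalPreorder hf h1 hyx) hxy hyx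
    · rcases mem_ready_insert.1 hy with h2 | ⟨rfl, -⟩
      · exact hA.antisymm (hA.ready_of_naturalPreorder hf h2 hxy) h2 hxy hyx
      · rfl

theorem IsSuccessorFn.mem_released_iff (hf : IsSuccessorFn f) (h : IsSucc f u a) :
    a ∈ Released f A ↔ u ∈ Ready f A :=
  ⟨fun ha => ha u h, fun hu _ hv => hf.left_unique h hv ▸ hu⟩

/-- When a vertex becomes ready, its successor is released. -/
theorem IsSuccessorFn.mem_released_insert (hf : IsSuccessorFn f) :
    x ∈ Released f (insert (a, w) A) ↔
      x ∈ Released f A ∨ (IsSucc f w x ∧ w ∈ Ready f (insert (a, w) A)) := by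
  constructor
  · intro h
    by_cases hx : IsSucc f w x
    · exact .inr ⟨hx, h w hx⟩
    · exact .inl fun u hu => (mem_ready_insert.1 (h u hu)).resolve_right fun h' => hx (h'.1 ▸ hu)
  · rintro (h | ⟨hx, h⟩)
    · exact Released.mono (Set.subset_insert _ _) h
    · exact (hf.mem_released_iff hx).2 h

/-- All influences into a ready vertex have been treated. -/
theorem IsSearch.below_iff_of_mem_ready (hA : IsSearch f A) (hf : IsSuccessorFn f)
    (hw : w ∈ Ready f A) : Below f A v w ↔ NaturalPreorder f v w := by
  constructor
  · rintro (⟨rfl, -⟩ | ⟨a, u, hu, ha, hvu⟩)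
    · exact .refl
    · exact hvu.tail (hf.influences_iff.2 ⟨a, hu, hA.releases ha⟩)
  · intro h
    rcases Relation.ReflTransGen.cases_tail h with h | ⟨u, hvu, huw⟩
    · exact .inl ⟨h.symm, hw⟩
    · obtain ⟨a, hu, ha⟩ := hf.influences_iff.1 huw
      exact .inr ⟨a, u, hu, hw a ha, hvu⟩

/-- The pair `(a, w)` adds below `w` what lies below the predecessor of `a`, and `w` itself if the
pair is the last one into `w`. -/
theorem below_insert :
    Below f (insert (a, w) A) v x ↔ Below f A v x ∨
      (x = w ∧ ((v = w ∧ w ∈ Ready f (insert (a, w) A)) ∨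
        ∃ u, IsSucc f u a ∧ NaturalPreorder f v u)) := by
  constructor
  · rintro (⟨rfl, h⟩ | ⟨b, u, hu, hb | hb, hvu⟩)
    · rcases mem_ready_insert.1 h with h | ⟨rfl, h⟩
      · exact .inl (.inl ⟨rfl, h⟩)
      · exact .inr ⟨rfl, .inl ⟨rfl, h⟩⟩
    · obtain ⟨rfl, rfl⟩ := Prod.mk.inj hb
      exact .inr ⟨rfl, .inr ⟨u, hu, hvu⟩⟩
    · exact .inl (.inr ⟨b, u, hu, hb, hvu⟩)
  · rintro ((⟨rfl, h⟩ | ⟨b, u, hu, hb, hvu⟩) | ⟨rfl, ⟨rfl, h⟩ | ⟨u, hu, hvu⟩⟩)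
    · exact .inl ⟨rfl, Ready.mono (Set.subset_insert _ _) h⟩
    · exact .inr ⟨b, u, hu, .inr hb, hvu⟩
    · exact .inl ⟨rfl, h⟩
    · exact .inr ⟨a, u, hu, .inl rfl, hvu⟩

theorem pending_eq_zero_iff [Finite V] : pending f A w = 0 ↔ w ∈ Ready f A := by
  rw [pending, Set.ncard_eq_zero (Set.toFinite _), Set.eq_empty_iff_forall_notMem]
  simp [Ready]

theorem pending_insert [Finite V] (haw : Releases f a w) (h : (a, w) ∉ A) :
    pending f (insert (a, w) A) w = pending f A w - 1 := by
  have hmem : a ∈ {b | Releases f b w ∧ (b, w) ∉ A} := ⟨haw, h⟩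
  rw [pending, pending, ← Set.ncard_sdiff_singleton_of_mem hmem]
  congr 1
  ext b
  simp only [Set.mem_insert_iff, Prod.mk.injEq, and_true, Set.mem_ofPred_eq, Set.mem_sdiff,
    Set.mem_singleton_iff]
  tauto

theorem pending_insert_of_ne (h : x ≠ w) : pending f (insert (a, w) A) x = pending f A x := by
  simp [pending, h]

/-- Of the closed neighbourhood of `w` only the successor of `w`, if there is one, does not
release `w`. -/
theorem IsSuccessorFn.pending_empty [Fintype V] [DecidableRel Γ.graph.Adj] [DecidableEq V]
    (hf : IsSuccessorFn f) (w : V) :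
    pending f ∅ w = Γ.graph.degree w + if w ∈ Γ.outputs then 1 else 0 := by
  have hcard : (insert w (Γ.graph.neighborFinset w)).card = Γ.graph.degree w + 1 := by
    rw [Finset.card_insert_of_notMem (by simp), SimpleGraph.card_neighborFinset_eq_degree]
  split_ifs with hw
  · rw [← hcard, pending, ← Set.ncard_coe_finset]
    congr 1
    ext a
    have : ¬ IsSucc f w a := fun h => h.1 hw
    simp [Releases, this, eq_comm, Γ.graph.adj_comm a w]
  · obtain ⟨b, hb⟩ := exists_isSucc_of_not_mem_outputs f hw
    have hmem : b ∈ insert w (Γ.graph.neighborFinset w) := by simp [hf.adj hb]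
    rw [add_zero, show Γ.graph.degree w = ((insert w (Γ.graph.neighborFinset w)).erase b).card by
      rw [Finset.card_erase_of_mem hmem, hcard]; rfl, pending, ← Set.ncard_coe_finset]
    congr 1
    ext a
    have : IsSucc f w a ↔ a = b := ⟨fun h => h.right_unique hb, fun h => h ▸ hb⟩
    simp [Releases, this, eq_comm, Γ.graph.adj_comm a w, and_comm]

/-- If every vertex has been released and has been passed through, there is no cycle. -/
theorem IsSearch.isPartialOrder (hA : IsSearch f A) (h : ∀ w, w ∈ Ready f A) :
    IsPartialOrder V (NaturalPreorder f) where
  refl _ := .refl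
  trans _ _ _ := .trans
  antisymm _ _ := hA.antisymm (h _) (h _)

/-- A minimal vertex among those that are not ready would be released by a vertex `f u` with `u`
still smaller. -/
theorem IsSuccessorFn.ready_of_isPartialOrder [Finite V] (hf : IsSuccessorFn f)
    (hpo : IsPartialOrder V (NaturalPreorder f))
    (hA : ∀ a ∈ Released f A, ∀ w, Releases f a w → (a, w) ∈ A) (w : V) : w ∈ Ready f A := by
  by_contra hw
  let _ : PartialOrder V :=
    { le := NaturalPreorder f
      le_refl := fun _ => .refl
      le_trans := fun _ _ _ => .trans
      le_antisymm := hpo.antisymm }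
  obtain ⟨m, -, hm⟩ := (Set.toFinite {x | x ∉ Ready f A}).exists_le_minimal hw
  obtain ⟨a, ha, haA⟩ : ∃ a, Releases f a m ∧ (a, m) ∉ A := by
    simpa [Ready] using hm.1
  have hnot : a ∉ Released f A := fun h => haA (hA a h m ha)
  obtain ⟨u, hu, hur⟩ : ∃ u, IsSucc f u a ∧ u ∉ Ready f A := by
    simpa [Released] using hnot
  have hum : Influences f u m := hf.influences_iff.2 ⟨a, hu, ha⟩
  have := hm.2 hur (show NaturalPreorder f u m from .single hum)
  exact hum.1 (hpo.antisymm _ _ (.single hum) this)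

end Search

/-! ### Path infima as maxima -/

section PathSup

open scoped Classical

variable {V : Type} [Fintype V] {d L : V → ℕ} {r r' : V → V → Prop} {w : V} {p : ℕ}

/-- The largest `d v + 1` over the vertices `v` with label `p` and `r v w`, and `0` if there are
none: the path infimum of `w`, increased by one as in the output array. -/
noncomputable def pathSup (d L : V → ℕ) (r : V → V → Prop) (w : V) (p : ℕ) : ℕ :=
  (Finset.univ.filter fun v => L v = p ∧ r v w).sup fun v => d v + 1

theorem pathSup_le_iff {b : ℕ} :
    pathSup d L r w p ≤ b ↔ ∀ v, L v = p → r v w → d v + 1 ≤ b := by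
  simp [pathSup]

theorem le_pathSup {v : V} (hL : L v = p) (hr : r v w) : d v + 1 ≤ pathSup d L r w p :=
  pathSup_le_iff.1 le_rfl v hL hr

theorem exists_of_pathSup_pos (h : 0 < pathSup d L r w p) :
    ∃ v, L v = p ∧ r v w ∧ d v + 1 = pathSup d L r w p := by
  have hne : (Finset.univ.filter fun v => L v = p ∧ r v w).Nonempty := by
    by_contra hne
    rw [Finset.not_nonempty_iff_eq_empty] at hne
    simp [pathSup, hne] at h
  obtain ⟨v, hv, he⟩ := Finset.exists_mem_eq_sup _ hne fun v => d v + 1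
  simp only [Finset.mem_filter, Finset.mem_univ, true_and] at hv
  exact ⟨v, hv.1, hv.2, he.symm⟩

theorem pathSup_congr {x : V} (h : ∀ v, r v w ↔ r' v x) :
    pathSup d L r w p = pathSup d L r' x p := by
  simp [pathSup, h]

theorem isPathInfima_pathSup (k : ℕ) {inf : V → ℕ → ℤ}
    (h : ∀ w p, 1 ≤ p → p ≤ k → inf w p = (pathSup d L r w p : ℤ) - 1) :
    IsPathInfima k r d L inf := by
  intro w p hp hpk
  rw [h w p hp hpk]
  rcases Nat.eq_zero_or_pos (pathSup d L r w p) with h0 | h0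
  · right
    refine ⟨fun v hv hr => ?_, by omega⟩
    have := le_pathSup (d := d) hv hr
    omega
  · left
    obtain ⟨v, hv, hr, he⟩ := exists_of_pathSup_pos h0
    refine ⟨⟨v, hv, hr, by omega⟩, ?_⟩
    rintro _ ⟨x, hx, hxr, rfl⟩
    have := le_pathSup (d := d) hx hxr
    omega

theorem isSystemOfInfima_pathSup {k : ℕ} {inf : V → ℕ → ℤ}
    (h : ∀ w p, 1 ≤ p → p ≤ k → inf w p = (pathSup d L r w p : ℤ) - 1)
    (hL : ∀ v, 1 ≤ L v ∧ L v ≤ k) (hr : ∀ {u v w}, r u v → r v w → r u w)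
    (hd : ∀ {v w}, L v = L w → d v ≤ d w → r v w) : IsSystemOfInfima r d L inf := by
  intro v w
  rw [h w _ (hL v).1 (hL v).2]
  constructor
  · intro hvw
    have := le_pathSup (d := d) (L := L) rfl hvw
    omega
  · intro hle
    obtain ⟨x, hx, hxr, he⟩ := exists_of_pathSup_pos (d := d) (L := L) (r := r) (w := w)
      (p := L v) (by omega)
    exact hr (hd hx.symm (by omega)) hxr

theorem pathSup_below_insert {Γ : Geometry V} {f : Γ.Fn} {A : Set (V × V)} {a : V} :
    pathSup d L (Below f (insert (a, w) A)) w p =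
      max (max (pathSup d L (Below f A) w p)
        (pathSup d L (fun v a => ∃ u, IsSucc f u a ∧ NaturalPreorder f v u) a p))
        (if L w = p ∧ w ∈ Ready f (insert (a, w) A) then d w + 1 else 0) := by
  refine eq_of_forall_ge_iff fun b => ?_
  have h3 : (if L w = p ∧ w ∈ Ready f (insert (a, w) A) then d w + 1 else 0) ≤ b ↔
      (L w = p → w ∈ Ready f (insert (a, w) A) → d w + 1 ≤ b) := by
    split_ifs with h
    · exact ⟨fun h _ _ => h, fun h' => h' h.1 h.2⟩
    · exact ⟨fun _ h1 h2 => absurd ⟨h1, h2⟩ h, fun _ => Nat.zero_le _⟩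
  rw [max_le_iff, max_le_iff, h3, pathSup_le_iff, pathSup_le_iff, pathSup_le_iff]
  constructor
  · intro h
    exact ⟨⟨fun v hv hr => h v hv (below_insert.2 (.inl hr)),
      fun v hv hr => h v hv (below_insert.2 (.inr ⟨rfl, .inr hr⟩))⟩,
      fun hL hw => h w hL (below_insert.2 (.inr ⟨rfl, .inl ⟨rfl, hw⟩⟩))⟩
  · rintro ⟨⟨h1, h2⟩, h3⟩ v hv hr
    rcases below_insert.1 hr with hr | ⟨-, ⟨rfl, hw⟩ | hr⟩
    · exact h1 v hv hr
    · exact h3 hv hw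
    · exact h2 v hv hr

theorem pathSup_below_insert_of_ne {Γ : Geometry V} {f : Γ.Fn} {A : Set (V × V)} {a x : V}
    (h : x ≠ w) :
    pathSup d L (Below f (insert (a, w) A)) x p = pathSup d L (Below f A) x p :=
  pathSup_congr fun v => by simp [below_insert, h]

end PathSup

end Geometry

namespace RAM

open Geometry

/-! ### Timed correctness of programs -/

section Runs

variable {p q : Prog} {s : State} {T T' : ℕ} {Q Q' : State → Prop} {e : Expr}

@[simp] theorem State.reg_setReg (s : State) (x v y : ℕ) :
    (s.setReg x v).reg y = if y = x then v else s.reg y := by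
  simp [State.setReg, Function.update_apply]

@[simp] theorem State.arr_setReg (s : State) (x v : ℕ) : (s.setReg x v).arr = s.arr := rfl

@[simp] theorem State.reg_setArr (s : State) (a i v : ℕ) : (s.setArr a i v).reg = s.reg := rfl

@[simp] theorem State.arr_setArr (s : State) (a i v b : ℕ) :
    (s.setArr a i v).arr b = if b = a then Function.update (s.arr a) i v else s.arr b := by
  simp [State.setArr, Function.update_apply]

theorem Expr.eval_eq_eq_zero {e₁ e₂ : Expr} :
    (Expr.eq e₁ e₂).eval s = 0 ↔ e₁.eval s ≠ e₂.eval s := by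
  simp [Expr.eval]

theorem Expr.eval_lt_eq_zero {e₁ e₂ : Expr} :
    (Expr.lt e₁ e₂).eval s = 0 ↔ ¬ e₁.eval s < e₂.eval s := by
  simp [Expr.eval]

/-- The program `p`, started in the state `s`, terminates within time `T` in a state that
satisfies `Q`. -/
def Runs (p : Prog) (s : State) (T : ℕ) (Q : State → Prop) : Prop :=
  ∃ t s', Exec p s t s' ∧ t ≤ T ∧ Q s'

theorem Runs.mono (h : Runs p s T Q) (hT : T ≤ T') (hQ : ∀ s', Q s' → Q' s') :
    Runs p s T' Q' := by
  obtain ⟨t, s', he, ht, hs⟩ := h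
  exact ⟨t, s', he, ht.trans hT, hQ _ hs⟩

theorem Runs.seq (h : Runs p s T fun s' => Runs q s' T' Q) : Runs (.seq p q) s (T + T') Q := by
  obtain ⟨t, s', he, ht, t', s'', he', ht', hs⟩ := h
  exact ⟨t + t', s'', .seq he he', by omega, hs⟩

theorem Runs.setReg {x : ℕ} (h : Q (s.setReg x (e.eval s))) :
    Runs (.setReg x e) s (e.cost + 1) Q :=
  ⟨_, _, .setReg x e s, le_rfl, h⟩

/-- The weakest precondition of a program without loops. -/
def Prog.wp : Prog → (State → Prop) → State → Prop
  | .skip, Q, s => Q s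
  | .setReg x e, Q, s => Q (s.setReg x (e.eval s))
  | .setArr a i e, Q, s => Q (s.setArr a (i.eval s) (e.eval s))
  | .seq p q, Q, s => p.wp (q.wp Q) s
  | .ite e p q, Q, s => (e.eval s ≠ 0 → p.wp Q s) ∧ (e.eval s = 0 → q.wp Q s)
  | .loop _ _, _, _ => False

/-- An upper bound for the running time of a program without loops. -/
def Prog.maxCost : Prog → ℕ
  | .skip => 1
  | .setReg _ e => e.cost + 1
  | .setArr _ i e => i.cost + e.cost + 1
  | .seq p q => p.maxCost + q.maxCost
  | .ite e p q => e.cost + 1 + max p.maxCost q.maxCost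
  | .loop _ _ => 0

theorem Runs.of_wp (h : p.wp Q s) : Runs p s p.maxCost Q := by
  induction p generalizing s Q with
  | skip => exact ⟨_, _, .skip s, le_rfl, h⟩
  | setReg x e => exact ⟨_, _, .setReg x e s, le_rfl, h⟩
  | setArr a i e => exact ⟨_, _, .setArr a i e s, le_rfl, h⟩
  | seq p q ihp ihq => exact .seq ((ihp h).mono le_rfl fun _ => ihq)
  | ite e p q ihp ihq =>
    by_cases he : e.eval s = 0
    · obtain ⟨t, s', hx, ht, hs⟩ := ihq (h.2 he)
      exact ⟨_, _, .ite_false he hx, by simp only [Prog.maxCost]; omega, hs⟩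
    · obtain ⟨t, s', hx, ht, hs⟩ := ihp (h.1 he)
      exact ⟨_, _, .ite_true he hx, by simp only [Prog.maxCost]; omega, hs⟩
  | loop e p _ => exact h.elim

theorem Runs.ite (h₁ : e.eval s ≠ 0 → Runs p s T Q) (h₂ : e.eval s = 0 → Runs q s T Q) :
    Runs (.ite e p q) s (e.cost + 1 + T) Q := by
  by_cases he : e.eval s = 0
  · obtain ⟨t, s', hx, ht, hs⟩ := h₂ he
    exact ⟨_, _, .ite_false he hx, by omega, hs⟩
  · obtain ⟨t, s', hx, ht, hs⟩ := h₁ he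
    exact ⟨_, _, .ite_true he hx, by omega, hs⟩

/-- An invariant `I B`, where `B` is the time that may still be used, bounds the running time of a
loop whose iterations differ in cost. -/
theorem Runs.loop {I : ℕ → State → Prop} {B : ℕ} (hs : I B s)
    (body : ∀ B s, I B s → e.eval s ≠ 0 →
      ∃ T B', e.cost + 1 + T + B' ≤ B ∧ Runs p s T (I B')) :
    Runs (.loop e p) s (B + e.cost + 1) fun s' => (∃ B', I B' s') ∧ e.eval s' = 0 := by
  induction B using Nat.strong_induction_on generalizing s with
  | _ B ih =>
    by_cases he : e.eval s = 0
    · exact ⟨_, _, .loop_false he, by omega, ⟨B, hs⟩, he⟩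
    · obtain ⟨T, B', hB, t, s', hx, ht, hs'⟩ := body B s hs he
      obtain ⟨t', s'', hx', ht', hQ⟩ := ih B' (by omega) hs'
      exact ⟨_, _, .loop_true he hx hx', by omega, hQ⟩

/-- The loop that runs `p` for the values of the register `x` from its present value up to and
excluding `e`. -/
def forUp (x : ℕ) (e : Expr) (p : Prog) : Prog :=
  .loop (.lt (.reg x) e) (.seq p (.setReg x (.add (.reg x) (.const 1))))

theorem Runs.forUp {x N i₀ : ℕ} {I : ℕ → State → Prop} (hx : s.reg x = i₀) (h₀ : i₀ ≤ N)
    (hs : I i₀ s) (hN : ∀ i s, I i s → e.eval s = N)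
    (body : ∀ i s, i₀ ≤ i → i < N → s.reg x = i → I i s →
      Runs p s T fun s' => s'.reg x = i ∧ I (i + 1) (s'.setReg x (i + 1)))
    (hQ : ∀ s', s'.reg x = N → I N s' → Q s') :
    Runs (forUp x e p) s ((N - i₀) * (T + e.cost + 7) + e.cost + 3) Q := by
  have h := Runs.loop (s := s) (e := .lt (.reg x) e)
    (p := .seq p (.setReg x (.add (.reg x) (.const 1))))
    (I := fun B s => ∃ i, i₀ ≤ i ∧ i ≤ N ∧ s.reg x = i ∧ I i s ∧ B = (N - i) * (T + e.cost + 7))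
    (B := (N - i₀) * (T + e.cost + 7)) ⟨i₀, le_rfl, h₀, hx, hs, rfl⟩ (by
      rintro B s ⟨i, hi₀, hiN, hi, hI, rfl⟩ he
      have hlt : i < N := by
        by_contra hlt
        simp [Expr.eval, hi, hN i s hI, hlt] at he
      refine ⟨T + 4, (N - (i + 1)) * (T + e.cost + 7), ?_, .seq
        ((body i s hi₀ hlt hi hI).mono le_rfl fun s' ⟨h1, h2⟩ => .setReg
          ⟨i + 1, by omega, hlt, ?_, ?_, rfl⟩)⟩
      · rw [show N - i = N - (i + 1) + 1 by omega, Nat.add_mul]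
        simp only [Expr.cost]
        omega
      · simp [Expr.eval, h1]
      · simpa [Expr.eval, h1] using h2)
  refine h.mono (by simp only [Expr.cost]; omega) ?_
  rintro s' ⟨⟨B, i, -, hiN, hi, hI, -⟩, he⟩
  have hNi : N ≤ i := by
    by_contra hlt
    simp [Expr.eval, hi, hN i s' hI, not_le.1 hlt] at he
  obtain rfl : i = N := by omega
  exact hQ s' hi hI

end Runs

/-! ### The program -/

/-! Registers: `0`, `1`, `2` hold `n`, `|I|`, `k`; `3` is a loop counter; `4` accumulates `n * k`; `5`
is the length of the queue, `6` the index of the vertex `a` of the queue that is treated; `7`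
holds `a`, `8` the predecessor `u` of `a`, `9` the vertex `w` that `a` releases; `10` runs through
the adjacency list of `a`, `11` through the path labels; `12` holds the successor of `w`.

Arrays: `0` to `4` are the input and `5` to `7` the output; `8` is the inverse of `f`, with value
`n` at the initial points; `9` holds the multiples of `k`, where the rows of array `7` start; `10`
counts the pairs into a vertex that have not been treated; `11` is the queue of the released
vertices. -/

/-- Tabulate the multiples of `k` and the sizes of the neighbourhoods. -/
def tabulate : Prog :=
  .seq (.setReg 4 (.const 0)) <| .seq (.setReg 3 (.const 0)) <| .seq
    (forUp 3 (.reg 0) <|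
      .seq (.setArr 9 (.reg 3) (.reg 4)) <|
      .seq (.setReg 4 (.add (.reg 4) (.reg 2))) <|
      .seq (.setArr 8 (.reg 3) (.reg 0)) <|
      .setArr 10 (.reg 3) (.add (.sub (.get 0 (.add (.reg 3) (.const 1))) (.get 0 (.reg 3)))
        (.eq (.get 4 (.reg 3)) (.const 0))))
    (.setArr 9 (.reg 3) (.reg 4))

/-- Set the rows `0, …, n` of the array of path infima to `0`. -/
def clearRows : Prog :=
  .seq (.setReg 3 (.const 0)) <|
    forUp 3 (.add (.add (.reg 4) (.reg 2)) (.const 1)) (.setArr 7 (.reg 3) (.const 0))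

/-- Invert `f`. -/
def invert : Prog :=
  .seq (.setReg 3 (.const 0)) <| forUp 3 (.reg 0) <|
    .ite (.get 4 (.reg 3)) (.setArr 8 (.sub (.get 4 (.reg 3)) (.const 1)) (.reg 3)) .skip

/-- Put the initial points into the queue. The length of the queue serves as the path label. -/
def enqueueInitial : Prog :=
  .seq (.setReg 5 (.const 0)) <| .seq (.setReg 3 (.const 0)) <| forUp 3 (.reg 0) <|
    .ite (.eq (.get 8 (.reg 3)) (.reg 0))
      (.seq (.setArr 11 (.reg 5) (.reg 3)) <|
        .seq (.setReg 5 (.add (.reg 5) (.const 1))) <|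
        .seq (.setArr 5 (.reg 3) (.const 0)) <|
        .setArr 6 (.reg 3) (.reg 5))
      .skip

/-- Replace the row of `w` by its entrywise maximum with the row of `u`; the maximum of `x` and `y`
is `x + (y - x)`. -/
def mergeRows : Prog :=
  .seq (.setReg 11 (.const 1)) <| forUp 11 (.add (.reg 2) (.const 1)) <|
    .setArr 7 (.add (.get 9 (.reg 9)) (.reg 11))
      (.add (.get 7 (.add (.get 9 (.reg 9)) (.reg 11)))
        (.sub (.get 7 (.add (.get 9 (.reg 8)) (.reg 11)))
          (.get 7 (.add (.get 9 (.reg 9)) (.reg 11)))))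

/-- If nothing is pending for `w` any more, enter `w` into its own row and release its
successor. -/
def complete : Prog :=
  .ite (.eq (.get 10 (.reg 9)) (.const 0))
    (.seq (.setArr 7 (.add (.get 9 (.reg 9)) (.get 6 (.reg 9)))
        (.add (.get 7 (.add (.get 9 (.reg 9)) (.get 6 (.reg 9))))
          (.sub (.add (.get 5 (.reg 9)) (.const 1))
            (.get 7 (.add (.get 9 (.reg 9)) (.get 6 (.reg 9))))))) <|
      .ite (.get 4 (.reg 9))
        (.seq (.setReg 12 (.sub (.get 4 (.reg 9)) (.const 1))) <|
          .seq (.setArr 11 (.reg 5) (.reg 12)) <|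
          .seq (.setReg 5 (.add (.reg 5) (.const 1))) <|
          .seq (.setArr 5 (.reg 12) (.add (.get 5 (.reg 9)) (.const 1))) <|
          .setArr 6 (.reg 12) (.get 6 (.reg 9)))
        .skip)
    .skip

/-- Treat the pair `(a, w)`. -/
def touch : Prog :=
  .seq mergeRows <| .seq (.setArr 10 (.reg 9) (.sub (.get 10 (.reg 9)) (.const 1))) complete

/-- Treat the pairs whose first entry is the vertex `a` at the present position of the queue. -/
def visit : Prog :=
  .seq (.setReg 7 (.get 11 (.reg 6))) <|
  .seq (.setReg 8 (.get 8 (.reg 7))) <|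
  .seq (.setReg 9 (.reg 7)) <|
  .seq touch <|
  .seq (.setReg 10 (.get 0 (.reg 7))) <|
  forUp 10 (.get 0 (.add (.reg 7) (.const 1))) <|
    .seq (.setReg 9 (.get 1 (.reg 10))) <| .ite (.eq (.reg 9) (.reg 8)) .skip touch

/-- Work off the queue. -/
def search : Prog :=
  .seq (.setReg 6 (.const 0)) <| .loop (.lt (.reg 6) (.reg 5)) <|
    .seq visit (.setReg 6 (.add (.reg 6) (.const 1)))

/-- The algorithm. The test rejects graphs with more than `n * k` edges. -/
def infimaProgram : Prog :=
  .seq tabulate <| .ite (.lt (.add (.reg 4) (.reg 4)) (.get 0 (.reg 0)))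
    (.setReg 0 (.const 0)) <|
    .seq clearRows <| .seq invert <| .seq enqueueInitial <| .seq search <|
      .setReg 0 (.eq (.reg 5) (.reg 0))

/-! ### Reading the input -/

section Input

variable {n : ℕ} {Γ : Geometry (Fin n)} {f : Γ.Fn} {s₀ s : State} {x y i : ℕ}

theorem HoldsInput.get_four_of_isSucc (h : HoldsInput s₀ Γ f) {v a : Fin n}
    (hva : IsSucc f v a) : s₀.arr 4 v = a + 1 := by
  obtain ⟨hv, rfl⟩ := hva
  exact h.succ_some v hv

theorem HoldsInput.get_four_eq_zero_iff (h : HoldsInput s₀ Γ f) (v : Fin n) :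
    s₀.arr 4 v = 0 ↔ v ∈ Γ.outputs := by
  refine ⟨fun h0 => ?_, h.succ_none v⟩
  by_contra hv
  have := h.succ_some v hv
  omega

theorem HoldsInput.degree_eq (h : HoldsInput s₀ Γ f) [DecidableRel Γ.graph.Adj] (v : Fin n) :
    Γ.graph.degree v = s₀.arr 0 (v + 1) - s₀.arr 0 v := by
  have h1 := (h.neighbours v).ncard_eq
  have h2 : {x : ℕ | ∃ w : Fin n, Γ.graph.Adj v w ∧ x = w} =
      Fin.val '' (Γ.graph.neighborFinset v : Set (Fin n)) := by
    ext x
    simp [eq_comm]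
  rw [h2, Set.ncard_image_of_injective _ Fin.val_injective, Set.ncard_coe_finset,
    SimpleGraph.card_neighborFinset_eq_degree] at h1
  rw [← h1, ← Finset.coe_Ico, Set.ncard_coe_finset, Nat.card_Ico]

/-- The last starting position of the adjacency lists is twice the number of edges. -/
theorem HoldsInput.sum_degree_eq (h : HoldsInput s₀ Γ f) [DecidableRel Γ.graph.Adj] :
    ∑ v, Γ.graph.degree v = s₀.arr 0 n := by
  have key : ∀ j ≤ n, ∑ i ∈ Finset.range j, (s₀.arr 0 (i + 1) - s₀.arr 0 i) = s₀.arr 0 j := by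
    intro j hj
    induction j with
    | zero => simp [h.offset_zero]
    | succ j ih =>
      have := h.offset_le ⟨j, hj⟩
      rw [Finset.sum_range_succ, ih (by omega)]
      simp only at this
      omega
  rw [← key n le_rfl, Finset.sum_range]
  exact Finset.sum_congr rfl fun v _ => h.degree_eq v

/-- `s` has the same contents as `s₀` where the input is stored. -/
def SameInput (s₀ s : State) : Prop :=
  (∀ x < 3, s.reg x = s₀.reg x) ∧ ∀ a < 5, s.arr a = s₀.arr a

theorem SameInput.refl (s : State) : SameInput s s := ⟨fun _ _ => rfl, fun _ _ => rfl⟩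

theorem SameInput.setReg (h : SameInput s₀ s) (hx : 3 ≤ x) : SameInput s₀ (s.setReg x y) :=
  ⟨fun z hz => by simp [show z ≠ x by omega, h.1 z hz], h.2⟩

theorem SameInput.setArr (h : SameInput s₀ s) (hx : 5 ≤ x) : SameInput s₀ (s.setArr x i y) :=
  ⟨h.1, fun z hz => by simp [show z ≠ x by omega, h.2 z hz]⟩

theorem SameInput.trans {s' : State} (h : SameInput s₀ s) (h' : SameInput s s') :
    SameInput s₀ s' :=
  ⟨fun x hx => (h'.1 x hx).trans (h.1 x hx), fun a ha => (h'.2 a ha).trans (h.2 a ha)⟩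

end Input

/-! ### Initialization -/

section Init

variable {n k : ℕ} {Γ : Geometry (Fin n)} {f : Γ.Fn} {d L : Fin n → ℕ} {s₀ s : State}

/-- Before any pair is treated, the number of pairs pending for `v` is its degree, or one more if
`v` is an output. -/
theorem runs_tabulate (h : HoldsInput s₀ Γ f) (hf : IsSuccessorFn f)
    (hk : Γ.outputs.card = k) :
    Runs tabulate s₀ (50 * (n + 1)) fun s => SameInput s₀ s ∧ s.reg 4 = n * k ∧
      (∀ v ≤ n, s.arr 9 v = v * k) ∧ (∀ v < n, s.arr 8 v = n) ∧
      ∀ v : Fin n, s.arr 10 v = pending f ∅ v := by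
  classical
  have hn := h.numVertices
  have hk' := h.numOutputs.trans hk
  refine Runs.mono (.seq (.setReg (.seq (.setReg (.seq (.forUp (i₀ := 0) (N := n)
    (I := fun i s => SameInput s₀ s ∧ s.reg 4 = i * k ∧
      (∀ v < i, s.arr 9 v = v * k) ∧ (∀ v < i, s.arr 8 v = n) ∧
      ∀ v : Fin n, v < i → s.arr 10 v = pending f ∅ v)
    ?_ (Nat.zero_le _) ?_ ?_ (fun i s _ hi hr hI => .of_wp ?_) fun s hr hI => .of_wp ?_))))))
    ?_ (fun _ => id)
  · simp [Expr.eval]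
  · refine ⟨(SameInput.refl _).setReg (by simp) |>.setReg (by simp), ?_⟩
    simp [Expr.eval]
  · rintro i s ⟨hI, -⟩
    simp [Expr.eval, hI.1, hn]
  · obtain ⟨hI, h4, h9, h8, h10⟩ := hI
    simp only [Prog.wp, Expr.eval]
    refine ⟨by simp [hr], ?_, ?_, ?_, ?_, ?_⟩
    · repeat first
        | exact hI
        | refine SameInput.setReg ?_ (by simp)
        | refine SameInput.setArr ?_ (by simp)
    · simp [h4, hI.1, hk', Nat.add_mul]
    · intro v hv
      rcases Nat.lt_succ_iff_lt_or_eq.1 hv with hv | rfl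
      · simp [hr, hv.ne, h9 v hv]
      · simp [hr, h4]
    · intro v hv
      rcases Nat.lt_succ_iff_lt_or_eq.1 hv with hv | rfl
      · simp [hr, hv.ne, h8 v hv]
      · simp [hr, hI.1, hn]
    · intro v hv
      rcases Nat.lt_succ_iff_lt_or_eq.1 hv with hv | rfl
      · simp [hr, hv.ne, h10 v hv]
      · simp [hr, hI.2, hf.pending_empty, h.degree_eq, h.get_four_eq_zero_iff]
  · obtain ⟨hI, h4, h9, h8, h10⟩ := hI
    simp only [Prog.wp, Expr.eval]
    refine ⟨hI.setArr (by simp), by simpa using h4, ?_, by simpa using h8, by simpa using h10⟩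
    intro v hv
    rcases hv.lt_or_eq with hv | rfl
    · simp [hr, hv.ne, h9 v hv]
    · simp [hr, h4]
  · simp only [Expr.cost, Prog.maxCost]
    omega

theorem runs_clearRows (h2 : s.reg 2 = k) (h4 : s.reg 4 = n * k) :
    Runs clearRows s (50 * (n * k + k + 1)) fun s' => (∀ x ≠ 3, s'.reg x = s.reg x) ∧
      (∀ a ≠ 7, s'.arr a = s.arr a) ∧ ∀ i ≤ n * k + k, s'.arr 7 i = 0 := by
  refine Runs.mono (.seq (.setReg (.forUp (i₀ := 0) (N := n * k + k + 1)
    (I := fun i s' => (∀ x ≠ 3, s'.reg x = s.reg x) ∧ (∀ a ≠ 7, s'.arr a = s.arr a) ∧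
      ∀ j < i, s'.arr 7 j = 0)
    ?_ (Nat.zero_le _) ?_ ?_ (fun i s' _ hi hr hI => .of_wp ?_) fun s' hr hI => ?_)))
    ?_ (fun _ => id)
  · simp [Expr.eval]
  · refine ⟨fun x hx => by simp [hx], fun _ _ => rfl, fun _ h => absurd h (Nat.not_lt_zero _)⟩
  · rintro i s' ⟨hI, -⟩
    simp [Expr.eval, hI, h2, h4]
  · obtain ⟨hI, hI', h7⟩ := hI
    simp only [Prog.wp, Expr.eval]
    refine ⟨by simp [hr], fun x hx => by simp [hx, hI], fun a ha => by simp [ha, hI'], ?_⟩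
    intro j hj
    rcases Nat.lt_succ_iff_lt_or_eq.1 hj with hj | rfl
    · simp [hr, hj.ne, h7 j hj]
    · simp [hr]
  · exact ⟨hI.1, hI.2.1, fun j hj => hI.2.2 j (by omega)⟩
  · simp [Expr.cost, Prog.maxCost]
    omega

theorem runs_invert (h : HoldsInput s₀ Γ f) (hf : IsSuccessorFn f) (hs : SameInput s₀ s)
    (h8 : ∀ v < n, s.arr 8 v = n) :
    Runs invert s (50 * (n + 1)) fun s' => SameInput s₀ s' ∧ (∀ a ≠ 8, s'.arr a = s.arr a) ∧
      (∀ u a : Fin n, IsSucc f u a → s'.arr 8 a = u) ∧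
      ∀ a : Fin n, IsInitial f a → s'.arr 8 a = n := by
  refine Runs.mono (.seq (.setReg (.forUp (i₀ := 0) (N := n)
    (I := fun i s' => SameInput s₀ s' ∧ (∀ a ≠ 8, s'.arr a = s.arr a) ∧
      (∀ u a : Fin n, IsSucc f u a → u < i → s'.arr 8 a = u) ∧
      ∀ a : Fin n, (∀ u, IsSucc f u a → i ≤ u) → s'.arr 8 a = n)
    ?_ (Nat.zero_le _) ?_ ?_ (fun i s' _ hi hr hI => .of_wp ?_) fun s' hr hI => ?_)))
    ?_ (fun _ => id)
  · simp [Expr.eval]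
  · exact ⟨hs.setReg (by simp), fun _ _ => rfl, fun _ _ _ h => absurd h (Nat.not_lt_zero _),
      fun a _ => h8 a a.2⟩
  · rintro i s' ⟨hI, -⟩
    simp [Expr.eval, hI.1, h.numVertices]
  · obtain ⟨hI, hI', h1, h2⟩ := hI
    simp only [Prog.wp, Expr.eval, hr, hI.2 4 (by simp)]
    refine ⟨fun h4 => ?_, fun h4 => ?_⟩
    · have hi4 := (h.get_four_eq_zero_iff ⟨i, hi⟩).not.1 h4
      obtain ⟨b, hb⟩ := exists_isSucc_of_not_mem_outputs f hi4
      have hb4 : s₀.arr 4 i = b + 1 := h.get_four_of_isSucc hb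
      refine ⟨by simp [hr], (hI.setArr (by simp)).setReg (by simp),
        fun a ha => by simp [ha, hI'], fun u a hu hui => ?_, fun a ha => ?_⟩
      · rcases Nat.lt_succ_iff_lt_or_eq.1 hui with hui | rfl
        · have hab : (a : ℕ) ≠ b := fun hab => by
            have := hf.left_unique hu (Fin.ext hab ▸ hb)
            simp [this] at hui
          simp [hb4, hab, h1 u a hu hui]
        · simp [hb4, hu.right_unique hb]
      · have hab : (a : ℕ) ≠ b := fun hab => by
          have := ha _ (Fin.ext hab ▸ hb)
          simp at this
        simp only [hb4, State.arr_setReg, State.arr_setArr, if_true, Nat.add_sub_cancel]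
        rw [Function.update_of_ne hab, h2 a fun u hu => (Nat.le_succ i).trans (ha u hu)]
    · have hi4 := (h.get_four_eq_zero_iff ⟨i, hi⟩).1 h4
      refine ⟨by simp, hI.setReg (by simp), hI', fun u a hu hui => h1 u a hu ?_,
        fun a ha => h2 a fun u hu => (Nat.le_succ i).trans (ha u hu)⟩
      rcases Nat.lt_succ_iff_lt_or_eq.1 hui with hui | rfl
      · exact hui
      · exact absurd hi4 hu.1
  · exact ⟨hI.1, hI.2.1, fun u a hu => hI.2.2.1 u a hu u.2,
      fun a ha => hI.2.2.2 a fun u hu => absurd hu (ha u)⟩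
  · simp [Expr.cost, Prog.maxCost]
    omega

/-- Append an element to a queue that is stored in an array. -/
theorem bijOn_update_Iio {q : ℕ → ℕ} {t x : ℕ} {X : Set ℕ} (h : Set.BijOn q (Set.Iio t) X)
    (hx : x ∉ X) : Set.BijOn (Function.update q t x) (Set.Iio (t + 1)) (insert x X) := by
  have h1 : Set.Iio (t + 1) = insert t (Set.Iio t) := by
    ext i
    simp only [Set.mem_Iio, Set.mem_insert_iff]
    omega
  have h2 : Set.EqOn q (Function.update q t x) (Set.Iio t) := fun i hi => by
    rw [Function.update_of_ne (ne_of_lt hi)]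
  rw [h1]
  simpa using (h.congr h2).insert (a := t) (by simpa using hx)

/-- After `i` rounds, the length of the queue is the number of initial points below `i`; so the
length after a point has been appended is the label of that point. -/
theorem runs_enqueueInitial (h : HoldsInput s₀ Γ f) (hL : IsOrderedLabelling f k d L)
    (hs : SameInput s₀ s) (h8 : ∀ u a : Fin n, IsSucc f u a → s.arr 8 a = u)
    (h8' : ∀ a : Fin n, IsInitial f a → s.arr 8 a = n) :
    Runs enqueueInitial s (50 * (n + 1)) fun s' => SameInput s₀ s' ∧
      (∀ a, a ≠ 5 → a ≠ 6 → a ≠ 11 → s'.arr a = s.arr a) ∧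
      Set.BijOn (s'.arr 11) (Set.Iio (s'.reg 5)) (Fin.val '' {a | IsInitial f a}) ∧
      ∀ a : Fin n, IsInitial f a → s'.arr 5 a = d a ∧ s'.arr 6 a = L a := by
  refine Runs.mono (.seq (.setReg (.seq (.setReg (.forUp (i₀ := 0) (N := n)
    (I := fun i s' => SameInput s₀ s' ∧
      (∀ a, a ≠ 5 → a ≠ 6 → a ≠ 11 → s'.arr a = s.arr a) ∧
      s'.reg 5 = {a : Fin n | IsInitial f a ∧ a < i}.ncard ∧
      Set.BijOn (s'.arr 11) (Set.Iio (s'.reg 5)) (Fin.val '' {a : Fin n | IsInitial f a ∧ a < i}) ∧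
      ∀ a : Fin n, IsInitial f a → a < i → s'.arr 5 a = d a ∧ s'.arr 6 a = L a)
    ?_ (Nat.zero_le _) ?_ ?_ (fun i s' _ hi hr hI => .of_wp ?_) fun s' hr hI => ?_)))))
    ?_ (fun _ => id)
  · simp [Expr.eval]
  · refine ⟨(hs.setReg (by simp)).setReg (by simp), fun _ _ _ _ => rfl, ?_, ?_, ?_⟩
    · simp [Expr.eval]
    · simp [Expr.eval]
    · simp
  · rintro i s' ⟨hI, -⟩
    simp [Expr.eval, hI.1, h.numVertices]
  · obtain ⟨hI, hI', h5, h11, hdL⟩ := hI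
    have h8i : s'.arr 8 = s.arr 8 := hI' 8 (by simp) (by simp) (by simp)
    have hn : s'.reg 0 = n := (hI.1 0 (by simp)).trans h.numVertices
    have hiff : s.arr 8 i = n ↔ IsInitial f ⟨i, hi⟩ := by
      refine ⟨fun h' u hu => ?_, h8' ⟨i, hi⟩⟩
      have := h8 u ⟨i, hi⟩ hu
      have := u.2
      simp only at *
      omega
    simp only [Prog.wp, ne_eq, Expr.eval_eq_eq_zero, not_not]
    simp only [Expr.eval, hr, h8i, hn, hiff]
    refine ⟨fun hini => ?_, fun hini => ?_⟩
    · have hset : {a : Fin n | IsInitial f a ∧ a < i + 1} =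
          insert ⟨i, hi⟩ {a : Fin n | IsInitial f a ∧ a < i} := by
        ext a
        simp only [Set.mem_ofPred_eq, Set.mem_insert_iff, Fin.ext_iff, Nat.lt_succ_iff_lt_or_eq]
        constructor
        · tauto
        · rintro (h' | h')
          · exact ⟨(Fin.ext h' : a = ⟨i, hi⟩) ▸ hini, .inr h'⟩
          · tauto
      have hcard : {a : Fin n | IsInitial f a ∧ a < i + 1}.ncard =
          {a : Fin n | IsInitial f a ∧ a < i}.ncard + 1 := by
        rw [hset, Set.ncard_insert_of_notMem (by simp) (Set.toFinite _)]
      refine ⟨by simp [hr], ?_, ?_, ?_, ?_, ?_⟩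
      · repeat first
          | exact hI
          | refine SameInput.setReg ?_ (by simp)
          | refine SameInput.setArr ?_ (by simp)
      · intro a h1 h2 h3
        simp [h1, h2, h3, hI' a h1 h2 h3]
      · rw [hcard]
        simp [h5]
      · simp only [State.reg_setReg, State.reg_setArr, State.arr_setReg, State.arr_setArr, hset,
          Set.image_insert_eq]
        simpa [hr] using bijOn_update_Iio h11 (x := i) fun ⟨x, hx, hxi⟩ => hx.2.ne hxi
      · intro a ha hai
        rcases Nat.lt_succ_iff_lt_or_eq.1 hai with hai | rfl
        · simpa [hr, hai.ne] using hdL a ha hai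
        · have hLa : L a = {x : Fin n | IsInitial f x ∧ x < (a : ℕ) + 1}.ncard := by
            rw [hL.label_initial ha]
            congr 1
            ext x
            simp only [Set.mem_ofPred_eq, Fin.le_def, Nat.lt_succ_iff]
          simp [hr, hL.dist_initial ha, hLa.trans hcard, h5]
    · have hlt : ∀ a : Fin n, IsInitial f a → a < i + 1 → a < i := by
        intro a ha hai
        rcases Nat.lt_succ_iff_lt_or_eq.1 hai with hai | rfl
        · exact hai
        · exact absurd ha hini
      have hset : {a : Fin n | IsInitial f a ∧ a < i + 1} =
          {a : Fin n | IsInitial f a ∧ a < i} := by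
        ext a
        exact ⟨fun h => ⟨h.1, hlt a h.1 h.2⟩, fun h => ⟨h.1, h.2.trans (Nat.lt_succ_self i)⟩⟩
      rw [← hset] at h5 h11
      exact ⟨by simp, hI.setReg (by simp), hI', by simpa using h5, by simpa using h11,
        fun a ha hai => hdL a ha (hlt a ha hai)⟩
  · obtain ⟨hI, hI', -, h11, hdL⟩ := hI
    refine ⟨hI, hI', by simpa using h11, fun a ha => hdL a ha a.2⟩
  · simp [Expr.cost, Prog.maxCost]
    omega

end Init

/-! ### Treating one pair -/

section Touch

variable {n k : ℕ} {Γ : Geometry (Fin n)} {f : Γ.Fn} {d L : Fin n → ℕ} {s₀ s : State}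
  {A : Set (Fin n × Fin n)}

theorem row_lt {x y p q : ℕ} (hp : p ≤ k) (hq : 1 ≤ q) (h : x < y) :
    x * k + p < y * k + q := by
  have h1 : (x + 1) * k ≤ y * k := Nat.mul_le_mul_right k h
  rw [Nat.add_mul] at h1
  omega

/-- Different entries of an array with columns `1, …, k` have different indices. -/
theorem entry_inj {x y p q : ℕ} (hp : 1 ≤ p) (hp' : p ≤ k) (hq : 1 ≤ q) (hq' : q ≤ k) :
    x * k + p = y * k + q ↔ x = y ∧ p = q := by
  refine ⟨fun h => ?_, by rintro ⟨rfl, rfl⟩; rfl⟩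
  rcases lt_trichotomy x y with hxy | rfl | hxy
  · have := row_lt hp' hq hxy
    omega
  · exact ⟨rfl, by omega⟩
  · have := row_lt hq' hp hxy
    omega

theorem runs_mergeRows {w u : ℕ} (h2 : s.reg 2 = k) (hw : s.arr 9 (s.reg 9) = w * k)
    (hu : s.arr 9 (s.reg 8) = u * k) (hwu : w ≠ u) :
    Runs mergeRows s (50 * (k + 1)) fun s' => (∀ x ≠ 11, s'.reg x = s.reg x) ∧
      (∀ a ≠ 7, s'.arr a = s.arr a) ∧ ∀ x p, 1 ≤ p → p ≤ k → s'.arr 7 (x * k + p) =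
        if x = w then max (s.arr 7 (w * k + p)) (s.arr 7 (u * k + p))
        else s.arr 7 (x * k + p) := by
  refine Runs.mono (.seq (.setReg (.forUp (i₀ := 1) (N := k + 1)
    (I := fun i s' => (∀ x ≠ 11, s'.reg x = s.reg x) ∧ (∀ a ≠ 7, s'.arr a = s.arr a) ∧
      ∀ x p, 1 ≤ p → p ≤ k → s'.arr 7 (x * k + p) =
        if x = w ∧ p < i then max (s.arr 7 (w * k + p)) (s.arr 7 (u * k + p))
        else s.arr 7 (x * k + p))
    ?_ (by omega) ?_ ?_ (fun i s' hi1 hi hr hI => .of_wp ?_) fun s' hr hI => ?_)))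
    ?_ (fun _ => id)
  · simp [Expr.eval]
  · refine ⟨fun x hx => by simp [hx], fun _ _ => rfl, fun x p hp _ => ?_⟩
    rw [if_neg (by omega)]
    rfl
  · rintro i s' ⟨hI, -⟩
    simp [Expr.eval, hI, h2]
  · obtain ⟨hI, hI', h7⟩ := hI
    simp only [Prog.wp, Expr.eval]
    refine ⟨by simp [hr], fun x hx => by simp [hx, hI], fun a ha => by simp [ha, hI'], ?_⟩
    intro x p hp hpk
    have hwi : s'.arr 7 (w * k + i) = s.arr 7 (w * k + i) := by
      rw [h7 w i hi1 (by omega), if_neg (by omega)]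
    have hui : s'.arr 7 (u * k + i) = s.arr 7 (u * k + i) := by
      rw [h7 u i hi1 (by omega), if_neg fun h => hwu h.1.symm]
    simp only [State.arr_setReg, State.arr_setArr, if_true, hr, hI 9 (by simp),
      hI 8 (by simp), hI' 9 (by simp), hw, hu, hwi, hui, Function.update_apply,
      entry_inj hp hpk hi1 (Nat.lt_succ_iff.1 hi), h7 x p hp hpk]
    by_cases hx : x = w
    · subst hx
      rcases lt_trichotomy p i with h | rfl | h
      · simp [h.ne, h, h.trans (Nat.lt_succ_self i)]
      · simp
        omega
      · rw [if_neg (by omega), if_neg (by omega), if_neg (by omega)]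
    · simp [hx]
  · refine ⟨hI.1, hI.2.1, fun x p hp hpk => ?_⟩
    rw [hI.2.2 x p hp hpk]
    simp [hpk]
  · simp only [Expr.cost, Prog.maxCost]
    omega

/-- The state of the memory after the pairs in `A` have been treated. -/
structure Invariant (k : ℕ) (f : Γ.Fn) (d L : Fin n → ℕ) (s₀ : State) (A : Set (Fin n × Fin n))
    (s : State) : Prop where
  isSearch : IsSearch f A
  sameInput : SameInput s₀ s
  pred : ∀ u a : Fin n, IsSucc f u a → s.arr 8 a = u
  pred_initial : ∀ a : Fin n, IsInitial f a → s.arr 8 a = n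
  offset : ∀ v ≤ n, s.arr 9 v = v * k
  pending : ∀ w : Fin n, s.arr 10 w = pending f A w
  queue : Set.BijOn (s.arr 11) (Set.Iio (s.reg 5)) (Fin.val '' Released f A)
  dist : ∀ a ∈ Released f A, s.arr 5 (a : Fin n) = d a
  label : ∀ a ∈ Released f A, s.arr 6 (a : Fin n) = L a
  row : ∀ (w : Fin n) (p : ℕ), 1 ≤ p → p ≤ k →
    s.arr 7 (w * k + p) = pathSup d L (Below f A) w p
  virtualRow : ∀ p, 1 ≤ p → p ≤ k → s.arr 7 (n * k + p) = 0

theorem Invariant.pred_le (h : Invariant k f d L s₀ A s) (a : Fin n) : s.arr 8 a ≤ n := by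
  rcases isInitial_or_exists_isSucc f a with hi | ⟨u, hu⟩
  · exact (h.pred_initial a hi).le
  · exact (h.pred u a hu).trans_le u.2.le

theorem Invariant.eq_pred_iff (h : Invariant k f d L s₀ A s) (w a : Fin n) :
    (w : ℕ) = s.arr 8 a ↔ IsSucc f w a := by
  refine ⟨fun hw => ?_, fun hw => (h.pred w a hw).symm⟩
  rcases isInitial_or_exists_isSucc f a with hi | ⟨u, hu⟩
  · rw [h.pred_initial a hi] at hw
    exact absurd hw w.2.ne
  · rw [h.pred u a hu] at hw
    exact Fin.ext hw ▸ hu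

/-- The row of the predecessor of `a`, or the virtual row if there is none, holds what the
influences `u → w` with `f u = a` contribute to the row of `w`. -/
theorem Invariant.row_pred (h : Invariant k f d L s₀ A s) (hf : IsSuccessorFn f) {a : Fin n}
    (ha : a ∈ Released f A) {p : ℕ} (hp : 1 ≤ p) (hpk : p ≤ k) :
    s.arr 7 (s.arr 8 a * k + p) =
      pathSup d L (fun v a => ∃ u, IsSucc f u a ∧ NaturalPreorder f v u) a p := by
  rcases isInitial_or_exists_isSucc f a with hi | ⟨u, hu⟩
  · rw [h.pred_initial a hi, h.virtualRow p hp hpk, eq_comm, ← Nat.le_zero, pathSup_le_iff]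
    rintro v - ⟨u, hu, -⟩
    exact absurd hu (hi u)
  · rw [h.pred u a hu, h.row u p hp hpk]
    refine pathSup_congr fun v => ?_
    rw [h.isSearch.below_iff_of_mem_ready hf (ha u hu)]
    exact ⟨fun hv => ⟨u, hu, hv⟩, fun ⟨x, hx, hv⟩ => hf.left_unique hu hx ▸ hv⟩

/-- Treating the pair `(a, w)` takes time `O(k)` and only appends to the queue. -/
theorem runs_touch (h : HoldsInput s₀ Γ f) (hf : IsSuccessorFn f)
    (hk : Γ.outputs.card = k) (hL : IsOrderedLabelling f k d L) (hI : Invariant k f d L s₀ A s)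
    {a w : Fin n} (ha : a ∈ Released f A) (haw : Releases f a w) (hA : (a, w) ∉ A)
    (h8 : s.reg 8 = s.arr 8 a) (h9 : s.reg 9 = w) :
    Runs touch s (150 * (k + 1)) fun s' => Invariant k f d L s₀ (insert (a, w) A) s' ∧
      (∀ x, 6 ≤ x → x ≤ 10 → s'.reg x = s.reg x) ∧ s.reg 5 ≤ s'.reg 5 ∧
      ∀ i < s.reg 5, s'.arr 11 i = s.arr 11 i := by
  classical
  have hne : (w : ℕ) ≠ s.arr 8 a := fun hw => haw.2 ((hI.eq_pred_iff w a).1 hw)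
  have h2 : s.reg 2 = k := (hI.sameInput.1 2 (by simp)).trans (h.numOutputs.trans hk)
  refine Runs.mono (.seq ((runs_mergeRows h2 (w := w) (u := s.arr 8 a)
    (by rw [h9, hI.offset w w.2.le]) (by rw [h8, hI.offset _ (hI.pred_le a)]) hne).mono le_rfl
      fun s₁ hs₁ => .of_wp ?_)) ?_ (fun _ => id)
  swap
  · simp [Expr.cost, Prog.maxCost, complete]
    omega
  obtain ⟨hreg, harr, hrow⟩ := hs₁
  set A' := insert (a, w) A with hA'
  -- The pair `(a, w)` does not release `w` itself, since `f w ≠ w`.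
  have hwA : w ∈ Released f A' ↔ w ∈ Released f A := by
    rw [hA', hf.mem_released_insert]
    exact or_iff_left fun h' => (hf.adj h'.1).ne rfl
  have hS : IsSearch f A' := hI.isSearch.insert hf haw ha
  have hsame : SameInput s₀ s₁ := hI.sameInput.trans
    ⟨fun x hx => hreg x (by omega), fun x hx => harr x (by omega)⟩
  have hpend : ∀ x : Fin n, Function.update (s₁.arr 10) w (s₁.arr 10 w - 1) x =
      Geometry.pending f A' x := by
    intro x
    rw [harr 10 (by simp)]
    by_cases hx : x = w
    · rw [hx, Function.update_self, hI.pending, hA', pending_insert haw hA]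
    · rw [Function.update_of_ne (by simpa [Fin.ext_iff] using hx), hI.pending, hA',
        pending_insert_of_ne hx]
  -- After the merge, only the entry of a ready `w` in its own row can be missing.
  have hrow' : ∀ (x : Fin n) (p : ℕ), 1 ≤ p → p ≤ k →
      max (s₁.arr 7 (x * k + p)) (if x = w ∧ L w = p ∧ w ∈ Ready f A' then d w + 1 else 0) =
        pathSup d L (Below f A') x p := by
    intro x p hp hpk
    rw [hrow x p hp hpk]
    by_cases hx : x = w
    · subst hx
      rw [if_pos rfl, hI.row x p hp hpk, hI.row_pred hf ha hp hpk, hA', pathSup_below_insert]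
      simp
    · rw [if_neg (by simpa [Fin.ext_iff] using hx), hA', pathSup_below_insert_of_ne hx,
        hI.row x p hp hpk]
      simp [hx]
  have hvirt : ∀ p, 1 ≤ p → p ≤ k → s₁.arr 7 (n * k + p) = 0 := by
    intro p hp hpk
    rw [hrow n p hp hpk, if_neg w.2.ne', hI.virtualRow p hp hpk]
  simp only [Prog.wp, complete, ne_eq, Expr.eval_eq_eq_zero, not_not]
  have e9 : s₁.reg 9 = w := (hreg 9 (by simp)).trans h9
  refine ⟨fun h10 => ?_, fun h10 => ?_⟩
  · have hready : w ∈ Ready f A' := by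
      rw [← pending_eq_zero_iff, ← hpend w]
      simpa [Expr.eval, e9] using h10
    -- As `w` releases itself, its distance and label have already been stored.
    have hwR : w ∈ Released f A := hwA.1 (hS.released (hready w (hf.releases_self w)))
    have e5 : s₁.arr 5 w = d w := by rw [harr 5 (by simp), hI.dist w hwR]
    have e6 : s₁.arr 6 w = L w := by rw [harr 6 (by simp), hI.label w hwR]
    have eoff : s₁.arr 9 w = w * k := by rw [harr 9 (by simp), hI.offset w w.2.le]
    have hrow'' : ∀ (x : Fin n) (p : ℕ), 1 ≤ p → p ≤ k →
        Function.update (s₁.arr 7) (w * k + L w)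
          (s₁.arr 7 (w * k + L w) + (d w + 1 - s₁.arr 7 (w * k + L w))) (x * k + p) =
        pathSup d L (Below f A') x p := by
      intro x p hp hpk
      rw [← hrow' x p hp hpk, Function.update_apply]
      simp only [entry_inj hp hpk (hL.pos w) (hL.le w), ← Fin.ext_iff, hready, and_true]
      by_cases hx : x = w ∧ p = L w
      · obtain ⟨rfl, rfl⟩ := hx
        simp
        omega
      · rw [if_neg hx, if_neg fun h' => hx ⟨h'.1, h'.2.symm⟩, Nat.max_zero]
    have hvirt' : ∀ p, 1 ≤ p → p ≤ k → Function.update (s₁.arr 7) (w * k + L w)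
          (s₁.arr 7 (w * k + L w) + (d w + 1 - s₁.arr 7 (w * k + L w))) (n * k + p) = 0 := by
      intro p hp hpk
      rw [Function.update_of_ne, hvirt p hp hpk]
      rw [Ne, entry_inj hp hpk (hL.pos w) (hL.le w)]
      exact fun h' => w.2.ne' h'.1
    refine ⟨fun h4 => ?_, fun h4 => ?_⟩
    -- If `w` has a successor `b`, then `b` is appended to the queue.
    · have hwO : w ∉ Γ.outputs := by
        rw [← h.get_four_eq_zero_iff, ← hsame.2 4 (by simp)]
        simpa [Expr.eval, e9] using h4
      obtain ⟨b, hb⟩ := exists_isSucc_of_not_mem_outputs f hwO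
      have e4 : s₁.arr 4 w = b + 1 := by rw [hsame.2 4 (by simp), h.get_four_of_isSucc hb]
      have hrel : Released f A' = insert b (Released f A) := by
        ext x
        rw [hA', hf.mem_released_insert, Set.mem_insert_iff, or_comm]
        exact or_congr_left ⟨fun hx => hx.1.right_unique hb, fun hx => ⟨hx ▸ hb, hready⟩⟩
      have hbR : b ∉ Released f A := fun h' => hA (h' w hb a haw)
      have hbw : (w : ℕ) ≠ b := fun h' => (hf.adj hb).ne (Fin.ext h')
      refine ⟨⟨hS, ?_, ?_, ?_, ?_, ?_, ?_, ?_, ?_, ?_, ?_⟩, ?_, ?_, ?_⟩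
      · repeat first
          | exact hsame
          | refine SameInput.setReg ?_ (by simp)
          | refine SameInput.setArr ?_ (by simp)
      · simpa [harr 8] using hI.pred
      · simpa [harr 8] using hI.pred_initial
      · simpa [harr 9] using hI.offset
      · simpa [Expr.eval, e9] using hpend
      · simpa [Expr.eval, hrel, hreg 5, harr 11, e9, e4, Set.image_insert_eq] using
          bijOn_update_Iio hI.queue (x := b) fun ⟨x, hx, hxb⟩ => hbR (Fin.ext hxb ▸ hx)
      · intro x hx
        rw [hrel] at hx
        by_cases hxb : x = b
        · simp [Expr.eval, e9, e4, e5, hxb, hL.dist_succ hb]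
        · simp [Expr.eval, e9, e4, Fin.val_inj, hxb, harr 5, hI.dist x (hx.resolve_left hxb)]
      · intro x hx
        rw [hrel] at hx
        by_cases hxb : x = b
        · simp [Expr.eval, e9, e4, e6, hxb, hL.label_succ hb]
        · simp [Expr.eval, e9, e4, Fin.val_inj, hxb, harr 6, hI.label x (hx.resolve_left hxb)]
      · simpa [Expr.eval, e9, eoff, e5, e6] using hrow''
      · simpa [Expr.eval, e9, eoff, e5, e6] using hvirt'
      · intro x hx hx'
        simp [hreg x (by omega), show x ≠ 12 by omega, show x ≠ 5 by omega]
      · simp [Expr.eval, hreg 5]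
      · intro i hi
        simp [Expr.eval, hreg 5, harr 11, hi.ne]
    · have hwO : w ∈ Γ.outputs := by
        rw [← h.get_four_eq_zero_iff, ← hsame.2 4 (by simp)]
        simpa [Expr.eval, e9] using h4
      have hrel : Released f A' = Released f A := by
        ext x
        rw [hA', hf.mem_released_insert]
        exact or_iff_left fun hx => hx.1.1 hwO
      refine ⟨⟨hS, ?_, ?_, ?_, ?_, ?_, ?_, ?_, ?_, ?_, ?_⟩, ?_, ?_, ?_⟩
      · repeat first
          | exact hsame
          | refine SameInput.setReg ?_ (by simp)
          | refine SameInput.setArr ?_ (by simp)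
      · simpa [harr 8] using hI.pred
      · simpa [harr 8] using hI.pred_initial
      · simpa [harr 9] using hI.offset
      · simpa [Expr.eval, e9] using hpend
      · simpa [hrel, hreg 5, harr 11] using hI.queue
      · simpa [hrel, harr 5] using hI.dist
      · simpa [hrel, harr 6] using hI.label
      · simpa [Expr.eval, e9, eoff, e5, e6] using hrow''
      · simpa [Expr.eval, e9, eoff, e5, e6] using hvirt'
      · intro x hx hx'
        simp [hreg x (by omega)]
      · simp [hreg 5]
      · simp [harr 11]
  · have hready : w ∉ Ready f A' := by
      rw [← pending_eq_zero_iff, ← hpend w]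
      simpa [Expr.eval, e9] using h10
    have hrel : Released f A' = Released f A := by
      ext x
      rw [hA', hf.mem_released_insert]
      exact or_iff_left fun hx => hready hx.2
    refine ⟨⟨hS, ?_, ?_, ?_, ?_, ?_, ?_, ?_, ?_, ?_, ?_⟩, ?_, ?_, ?_⟩
    · repeat first
        | exact hsame
        | refine SameInput.setReg ?_ (by simp)
        | refine SameInput.setArr ?_ (by simp)
    · simpa [harr 8] using hI.pred
    · simpa [harr 8] using hI.pred_initial
    · simpa [harr 9] using hI.offset
    · simpa [Expr.eval, e9] using hpend
    · simpa [hrel, hreg 5, harr 11] using hI.queue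
    · simpa [hrel, harr 5] using hI.dist
    · simpa [hrel, harr 6] using hI.label
    · simpa [Expr.eval, e9, hready] using hrow'
    · simpa [Expr.eval, e9] using hvirt
    · intro x hx hx'
      simp [hreg x (by omega)]
    · simp [hreg 5]
    · simp [harr 11]

end Touch

/-! ### Working off the queue -/

section Search

variable {n k : ℕ} {Γ : Geometry (Fin n)} {f : Γ.Fn} {d L : Fin n → ℕ} {s₀ s : State}
  {H : Set (Fin n)}

/-- The pairs that have been treated when the vertices in `H` have been worked off. -/
def treated (f : Γ.Fn) (H : Set (Fin n)) : Set (Fin n × Fin n) :=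
  {x | Releases f x.1 x.2 ∧ x.1 ∈ H}

theorem Invariant.setReg {A : Set (Fin n × Fin n)} (h : Invariant k f d L s₀ A s) {x y : ℕ}
    (hx : 3 ≤ x) (hx' : x ≠ 5) : Invariant k f d L s₀ A (s.setReg x y) :=
  { h with
    sameInput := h.sameInput.setReg hx
    queue := by simpa [hx'.symm] using h.queue }

/-- Working off the vertex `a` takes time `O(k)` for each vertex of its closed neighbourhood. -/
theorem runs_visit (h : HoldsInput s₀ Γ f) (hf : IsSuccessorFn f)
    (hk : Γ.outputs.card = k) (hL : IsOrderedLabelling f k d L)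
    (hI : Invariant k f d L s₀ (treated f H) s) {a : Fin n} (haH : a ∉ H)
    (ha : a ∈ Released f (treated f H)) (h6 : s.arr 11 (s.reg 6) = a) :
    Runs visit s (200 * (k + 1) * (s₀.arr 0 (a + 1) - s₀.arr 0 a + 1))
      fun s' => Invariant k f d L s₀ (treated f (insert a H)) s' ∧
        s'.reg 6 = s.reg 6 ∧ s.reg 5 ≤ s'.reg 5 ∧ ∀ i < s.reg 5, s'.arr 11 i = s.arr 11 i := by
  classical
  -- The pairs that have been treated when the adjacency list of `a` has been read up to `j`.
  set A : ℕ → Set (Fin n × Fin n) := fun j => treated f H ∪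
    {x | Releases f x.1 x.2 ∧ x.1 = a ∧
      (x.2 = a ∨ ∃ i, s₀.arr 0 a ≤ i ∧ i < j ∧ s₀.arr 1 i = x.2)} with hA
  have hstart : insert (a, a) (treated f H) = A (s₀.arr 0 a) := by
    ext ⟨b, w⟩
    simp only [hA, Set.mem_insert_iff, Set.mem_union, Set.mem_ofPred_eq, Prod.mk.injEq]
    constructor
    · rintro (⟨rfl, rfl⟩ | h')
      · exact .inr ⟨hf.releases_self _, rfl, .inl rfl⟩
      · exact .inl h'
    · rintro (h' | ⟨-, rfl, rfl | ⟨i, h1, h2, -⟩⟩)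
      · exact .inr h'
      · exact .inl ⟨rfl, rfl⟩
      · omega
  have hend : A (s₀.arr 0 (a + 1)) = treated f (insert a H) := by
    ext ⟨b, w⟩
    simp only [hA, treated, Set.mem_union, Set.mem_ofPred_eq, Set.mem_insert_iff]
    constructor
    · rintro (h' | h')
      · exact ⟨h'.1, .inr h'.2⟩
      · exact ⟨h'.1, .inl h'.2.1⟩
    · rintro ⟨h', rfl | hb⟩
      · refine .inr ⟨h', rfl, h'.1.imp id fun hadj => ?_⟩
        obtain ⟨i, hi, hiw⟩ := (h.neighbours b).surjOn ⟨w, hadj, rfl⟩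
        exact ⟨i, hi.1, hi.2, hiw⟩
      · exact .inl ⟨h', hb⟩
  have hstep : ∀ j, s₀.arr 0 a ≤ j → ∀ w : Fin n, s₀.arr 1 j = w → Γ.graph.Adj a w →
      A (j + 1) = if IsSucc f w a then A j else insert (a, w) (A j) := by
    intro j hj w hw hadj
    have key : ∀ b x, (b, x) ∈ A (j + 1) ↔
        (b, x) ∈ A j ∨ (Releases f a w ∧ (b, x) = (a, w)) := by
      intro b x
      simp only [hA, Set.mem_union, Set.mem_ofPred_eq, Prod.mk.injEq]
      constructor
      · rintro (h' | ⟨h', rfl, rfl | ⟨i, h1, h2, h3⟩⟩)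
        · exact .inl (.inl h')
        · exact .inl (.inr ⟨h', rfl, .inl rfl⟩)
        · rcases Nat.lt_succ_iff_lt_or_eq.1 h2 with h2 | rfl
          · exact .inl (.inr ⟨h', rfl, .inr ⟨i, h1, h2, h3⟩⟩)
          · obtain rfl : x = w := Fin.ext (h3.symm.trans hw)
            exact .inr ⟨h', rfl, rfl⟩
      · rintro ((h' | ⟨h', rfl, h1 | ⟨i, h1, h2, h3⟩⟩) | ⟨h', rfl, rfl⟩)
        · exact .inl h'
        · exact .inr ⟨h', rfl, .inl h1⟩
        · exact .inr ⟨h', rfl, .inr ⟨i, h1, by omega, h3⟩⟩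
        · exact .inr ⟨h', rfl, .inr ⟨j, hj, Nat.lt_succ_self j, hw⟩⟩
    ext ⟨b, x⟩
    rw [key]
    split_ifs with hs
    · exact or_iff_left fun h' => h'.1.2 hs
    · rw [Set.mem_insert_iff, or_comm]
      exact or_congr_left ⟨fun h' => h'.2, fun h' => ⟨⟨.inr hadj, hs⟩, h'⟩⟩
  have hnew : ∀ j, s₀.arr 0 a ≤ j → j < s₀.arr 0 (a + 1) →
      ∃ w : Fin n, s₀.arr 1 j = w ∧ Γ.graph.Adj a w ∧ (a, w) ∉ A j := by
    intro j hj hj'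
    obtain ⟨w, hadj, hw⟩ := (h.neighbours a).mapsTo ⟨hj, hj'⟩
    refine ⟨w, hw, hadj, ?_⟩
    rintro (h' | ⟨-, -, h1 | ⟨i, h1, h2, h3⟩⟩)
    · exact haH h'.2
    · exact hadj.ne' h1
    · exact h2.ne ((h.neighbours a).injOn ⟨h1, h2.trans hj'⟩ ⟨hj, hj'⟩ (h3.trans hw.symm))
  have hsub : ∀ j, treated f H ⊆ A j := fun j => Set.subset_union_left
  refine Runs.mono (.seq (.setReg (.seq (.setReg (.seq (.setReg (.seq ((runs_touch h hf hk hL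
    (A := treated f H) (a := a) (w := a) ?_ ha (hf.releases_self a) ?_ ?_ ?_).mono le_rfl
    fun s₁ hs₁ => .seq (.setReg
    (.forUp (i₀ := s₀.arr 0 a) (N := s₀.arr 0 (a + 1))
    (I := fun j s' => Invariant k f d L s₀ (A j) s' ∧
      s'.reg 6 = s.reg 6 ∧ s'.reg 7 = a ∧ s'.reg 8 = s.arr 8 a ∧
      s.reg 5 ≤ s'.reg 5 ∧ ∀ i < s.reg 5, s'.arr 11 i = s.arr 11 i)
    ?_ (h.offset_le a) ?_ ?_ (fun j s' hj hj' hr hI' => .seq (.setReg (.ite (T := 150 * (k + 1))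
      (fun he => ?_) fun he => ?_))) fun s' hr hI' => ?_))))))))))
    ?_ (fun _ => id)
  · exact ((hI.setReg (by simp) (by simp)).setReg (by simp) (by simp)).setReg (by simp) (by simp)
  · exact fun h' => haH h'.2
  · simp [Expr.eval, h6]
  · simp [Expr.eval, h6]
  · obtain ⟨hI₁, hr₁, -, -⟩ := hs₁
    have h7 : s₁.reg 7 = a := by simp [hr₁ 7, Expr.eval, h6]
    simp [Expr.eval, h7, hI₁.sameInput.2]
  · obtain ⟨hI₁, hr₁, ht₁, hq₁⟩ := hs₁
    rw [hstart] at hI₁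
    refine ⟨hI₁.setReg (by simp) (by simp), ?_, ?_, ?_, ?_, ?_⟩
    · simp [hr₁ 6]
    · simp [hr₁ 7, Expr.eval, h6]
    · simp [hr₁ 8, Expr.eval, h6]
    · simpa using ht₁
    · simpa using hq₁
  · rintro j s' ⟨hI', -, h7, -⟩
    simp [Expr.eval, h7, hI'.sameInput.2]
  · obtain ⟨hI', h6', h7', h8', ht', hq'⟩ := hI'
    obtain ⟨w, hw, hadj, -⟩ := hnew j hj hj'
    have hsucc : IsSucc f w a := by
      rw [← hI.eq_pred_iff, ← hw]
      by_contra hne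
      refine he (Expr.eval_eq_eq_zero.2 ?_)
      simpa [Expr.eval, hr, hI'.sameInput.2, h8'] using hne
    -- The neighbour `w` is the predecessor of `a`, so `a` does not release it.
    refine Runs.mono (T := 1) (.of_wp (p := .skip) ?_) (by omega) (fun _ => id)
    refine ⟨by simp [hr], ?_, by simp [h6'], by simp [h7'], by simp [h8'], by simpa using ht',
      by simpa using hq'⟩
    rw [hstep j hj w hw hadj, if_pos hsucc]
    exact (hI'.setReg (by simp) (by simp)).setReg (by simp) (by simp)
  · obtain ⟨hI', h6', h7', h8', ht', hq'⟩ := hI'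
    obtain ⟨w, hw, hadj, hwA⟩ := hnew j hj hj'
    have hsucc : ¬ IsSucc f w a := by
      rw [← hI.eq_pred_iff, ← hw]
      rw [Expr.eval_eq_eq_zero] at he
      simpa [Expr.eval, hr, hI'.sameInput.2, h8'] using he
    have h8a : s'.arr 8 a = s.arr 8 a := by
      rcases isInitial_or_exists_isSucc f a with hi | ⟨u, hu⟩
      · rw [hI.pred_initial a hi, hI'.pred_initial a hi]
      · rw [hI.pred u a hu, hI'.pred u a hu]
    refine (runs_touch h hf hk hL (hI'.setReg (by simp) (by simp)) (a := a) (w := w)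
      (Released.mono (hsub j) ha) ⟨.inr hadj, hsucc⟩ hwA (by simp [h8', h8a])
      (by simp [Expr.eval, hr, hI'.sameInput.2, hw])).mono le_rfl ?_
    rintro s'' ⟨hI'', hr'', ht'', hq''⟩
    simp only [State.reg_setReg, State.arr_setReg] at hr'' ht'' hq''
    refine ⟨by simp [hr'', hr], ?_, by simp [hr'', h6'], by simp [hr'', h7'],
      by simp [hr'', h8'], by simpa using ht'.trans ht'', ?_⟩
    · rw [hstep j hj w hw hadj, if_neg hsucc]
      exact hI''.setReg (by simp) (by simp)
    · intro i hi
      simpa [hq' i hi] using hq'' i (by simpa using hi.trans_le ht')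
  · obtain ⟨hI', h6', -, -, ht', hq'⟩ := hI'
    exact ⟨hend ▸ hI', h6', ht', hq'⟩
  · simp only [Expr.cost]
    generalize s₀.arr 0 (a + 1) - s₀.arr 0 a = D
    nlinarith [Nat.zero_le (D * k)]

theorem treated_empty : treated f ∅ = ∅ := by
  simp [treated]

/-- The vertices that have not been worked off yet pay for the remaining running time. -/
theorem runs_search (h : HoldsInput s₀ Γ f) (hf : IsSuccessorFn f)
    (hk : Γ.outputs.card = k) (hL : IsOrderedLabelling f k d L)
    (hI : Invariant k f d L s₀ ∅ s) :
    Runs search s (200 * (k + 1) * (s₀.arr 0 n + n) + 8 * n + 10) fun s' =>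
      ∃ H, Invariant k f d L s₀ (treated f H) s' ∧ H = Released f (treated f H) := by
  classical
  set cost : Fin n → ℕ := fun a =>
    200 * (k + 1) * (s₀.arr 0 (a + 1) - s₀.arr 0 a + 1) + 8 with hcost
  have hsum : ∑ a, cost a = 200 * (k + 1) * (s₀.arr 0 n + n) + 8 * n := by
    simp only [hcost, Finset.sum_add_distrib, ← Finset.mul_sum, ← h.degree_eq, h.sum_degree_eq]
    simp [mul_comm]
  refine Runs.mono (.seq (.setReg ((Runs.loop (B := ∑ a, cost a) (I := fun B s =>
    ∃ H : Finset (Fin n), Invariant k f d L s₀ (treated f H) s ∧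
      (∀ a : Fin n, a ∈ H ↔ ∃ i < s.reg 6, s.arr 11 i = a) ∧ s.reg 6 ≤ s.reg 5 ∧
      B = ∑ a ∈ Hᶜ, cost a) ?_ ?_).mono le_rfl fun s' hs' => ?_))) ?_ (fun _ => id)
  · refine ⟨∅, ?_, by simp [Expr.eval], by simp [Expr.eval], by simp⟩
    rw [Finset.coe_empty, treated_empty]
    exact hI.setReg (by simp) (by simp)
  · rintro B s ⟨H, hI, hH, hle, rfl⟩ he
    have hlt : s.reg 6 < s.reg 5 := by
      by_contra hlt
      exact he (Expr.eval_lt_eq_zero.2 hlt)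
    obtain ⟨a, ha, ha6⟩ := hI.queue.mapsTo hlt
    have haH : a ∉ H := by
      rw [hH]
      rintro ⟨i, hi, hia⟩
      exact hi.ne (hI.queue.injOn (hi.trans hlt) hlt (hia.trans ha6))
    refine ⟨_, ∑ x ∈ (insert a H)ᶜ, cost x, ?_, .seq ((runs_visit h hf hk hL hI
      (by simpa using haH) ha ha6.symm).mono le_rfl fun s' hs' => .setReg ?_)⟩
    · rw [Finset.compl_insert, ← Finset.add_sum_erase Hᶜ cost (Finset.mem_compl.2 haH)]
      simp only [Expr.cost, hcost]
      omega
    · obtain ⟨hI', h6, h5, hq⟩ := hs'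
      refine ⟨insert a H, ?_, ?_, ?_, rfl⟩
      · rw [Finset.coe_insert]
        exact hI'.setReg (by simp) (by simp)
      · intro b
        simp only [Expr.eval, State.reg_setReg, State.arr_setReg, if_true, h6,
          Finset.mem_insert, hH]
        constructor
        · rintro (rfl | ⟨i, hi, hib⟩)
          · exact ⟨s.reg 6, Nat.lt_succ_self _, (hq _ hlt).trans ha6.symm⟩
          · exact ⟨i, by omega, (hq i (hi.trans hlt)).trans hib⟩
        · rintro ⟨i, hi, hib⟩
          rw [hq i (by omega)] at hib
          rcases Nat.lt_succ_iff_lt_or_eq.1 hi with hi | rfl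
          · exact .inr ⟨i, hi, hib⟩
          · exact .inl (Fin.ext (hib.symm.trans ha6.symm))
      · simp [Expr.eval, h6]
        omega
  · obtain ⟨⟨B, H, hI', hH, hle, -⟩, he⟩ := hs'
    refine ⟨H, hI', ?_⟩
    have heq : s'.reg 6 = s'.reg 5 := le_antisymm hle (not_lt.1 (Expr.eval_lt_eq_zero.1 he))
    ext a
    rw [Finset.mem_coe, hH, heq]
    constructor
    · rintro ⟨i, hi, hia⟩
      obtain ⟨b, hb, hbi⟩ := hI'.queue.mapsTo hi
      exact Fin.ext (hbi.trans hia) ▸ hb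
    · intro ha
      exact hI'.queue.surjOn ⟨a, ha, rfl⟩
  · simp only [Expr.cost, hsum]
    omega

end Search

/-! ### The whole program -/

section Main

variable {n k : ℕ} {Γ : Geometry (Fin n)} {f : Γ.Fn} {d L : Fin n → ℕ} {s₀ s : State}

theorem invariant_empty (hf : IsSuccessorFn f) (hs : SameInput s₀ s)
    (hpred : ∀ u a : Fin n, IsSucc f u a → s.arr 8 a = u)
    (hinit : ∀ a : Fin n, IsInitial f a → s.arr 8 a = n) (hoff : ∀ v ≤ n, s.arr 9 v = v * k)
    (hpend : ∀ w : Fin n, s.arr 10 w = pending f ∅ w)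
    (hq : Set.BijOn (s.arr 11) (Set.Iio (s.reg 5)) (Fin.val '' {a | IsInitial f a}))
    (hdL : ∀ a : Fin n, IsInitial f a → s.arr 5 a = d a ∧ s.arr 6 a = L a)
    (h7 : ∀ i ≤ n * k + k, s.arr 7 i = 0) : Invariant k f d L s₀ ∅ s where
  isSearch := hf.isSearch_empty
  sameInput := hs
  pred := hpred
  pred_initial := hinit
  offset := hoff
  pending := hpend
  queue := hf.released_empty.symm ▸ hq
  dist a ha := (hdL a (hf.released_empty.subset ha)).1
  label a ha := (hdL a (hf.released_empty.subset ha)).2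
  row w p hp hpk := by
    have := Nat.mul_le_mul_right k w.2.le
    rw [h7 _ (by omega), eq_comm, ← Nat.le_zero, pathSup_le_iff]
    rintro v - (⟨-, hv⟩ | ⟨a, u, -, ha, -⟩)
    · simp [hf.ready_empty] at hv
    · exact ha.elim
  virtualRow p hp hpk := h7 _ (by omega)

/-- The output that is required of the algorithm. -/
def IsOutput (k : ℕ) (f : Γ.Fn) (s' : State) : Prop :=
  (s'.reg 0 = 0 ∧ ¬ IsPartialOrder (Fin n) (NaturalPreorder f)) ∨
    (s'.reg 0 = 1 ∧ IsPartialOrder (Fin n) (NaturalPreorder f) ∧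
      (∀ v : Fin n, 1 ≤ outPath s' v ∧ outPath s' v ≤ k) ∧
      IsPathLabelling f (outDist s') (outPath s') ∧
      IsSystemOfInfima (NaturalPreorder f) (outDist s') (outPath s') (outInf k s') ∧
      IsPathInfima k (NaturalPreorder f) (outDist s') (outPath s') (outInf k s'))

/-- When the queue has been worked off, its length decides whether there is a cycle. -/
theorem Invariant.isOutput {H : Set (Fin n)} (hI : Invariant k f d L s₀ (treated f H) s)
    (h : HoldsInput s₀ Γ f) (hf : IsSuccessorFn f) (hL : IsOrderedLabelling f k d L)
    (hH : H = Released f (treated f H)) :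
    IsOutput k f (s.setReg 0 (Expr.eval s (.eq (.reg 5) (.reg 0)))) := by
  have hn : s.reg 0 = n := (hI.sameInput.1 0 (by simp)).trans h.numVertices
  have hclosed : ∀ a ∈ Released f (treated f H), ∀ w, Releases f a w → (a, w) ∈ treated f H :=
    fun a ha w haw => ⟨haw, hH ▸ ha⟩
  have hcard : s.reg 5 = (Released f (treated f H)).ncard := by
    have := hI.queue.ncard_eq
    rwa [Set.ncard_image_of_injective _ Fin.val_injective, ← Finset.coe_Iio, Set.ncard_coe_finset,
      Nat.card_Iio] at this
  by_cases h5 : s.reg 5 = n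
  · have huniv : Released f (treated f H) = Set.univ :=
      Set.eq_of_subset_of_ncard_le (Set.subset_univ _) (by
        rw [← hcard, h5, Set.ncard_univ, Nat.card_eq_fintype_card, Fintype.card_fin])
    have hready : ∀ w, w ∈ Ready f (treated f H) := fun w a ha =>
      hclosed a (huniv ▸ Set.mem_univ a) w ha
    have hd : ∀ v : Fin n, s.arr 5 v = d v := fun v => hI.dist v (huniv ▸ Set.mem_univ v)
    have hl : ∀ v : Fin n, s.arr 6 v = L v := fun v => hI.label v (huniv ▸ Set.mem_univ v)
    have hdist : outDist (s.setReg 0 (Expr.eval s (.eq (.reg 5) (.reg 0)))) = d := funext hd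
    have hpath : outPath (s.setReg 0 (Expr.eval s (.eq (.reg 5) (.reg 0)))) = L := funext hl
    have hinf : ∀ (w : Fin n) (p : ℕ), 1 ≤ p → p ≤ k →
        outInf k (s.setReg 0 (Expr.eval s (.eq (.reg 5) (.reg 0)))) w p =
          (pathSup d L (NaturalPreorder f) w p : ℤ) - 1 := by
      intro w p hp hpk
      simp only [outInf, State.arr_setReg, hI.row w p hp hpk]
      rw [pathSup_congr fun v => hI.isSearch.below_iff_of_mem_ready hf (hready w)]
    refine .inr ⟨by simp [Expr.eval, hn, h5], hI.isSearch.isPartialOrder hready, ?_⟩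
    rw [hdist, hpath]
    exact ⟨fun v => ⟨hL.pos v, hL.le v⟩, hL.isPathLabelling,
      isSystemOfInfima_pathSup hinf (fun v => ⟨hL.pos v, hL.le v⟩) .trans
        (hL.naturalPreorder hf), isPathInfima_pathSup k hinf⟩
  · refine .inl ⟨by simp [Expr.eval, hn, h5], fun hpo => h5 ?_⟩
    have hready := hf.ready_of_isPartialOrder hpo hclosed
    have huniv : Released f (treated f H) = Set.univ :=
      Set.eq_univ_of_forall fun a u _ => hready u
    rw [hcard, huniv, Set.ncard_univ, Nat.card_eq_fintype_card, Fintype.card_fin]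

/-- A graph with too many edges is rejected after time `O(n)`, before its edges are read. -/
theorem runs_infimaProgram_of_lt (h : HoldsInput s₀ Γ f) (hf : IsSuccessorFn f)
    (hk : Γ.outputs.card = k) (hL : IsOrderedLabelling f k d L)
    (hlt : n * k + n * k < s₀.arr 0 n) :
    Runs infimaProgram s₀ (100 * (n + 1)) (IsOutput k f) := by
  classical
  refine Runs.mono (.seq ((runs_tabulate h hf hk).mono le_rfl
    fun s₁ hs₁ => .ite (T := 2) (fun _ => .setReg (.inl ⟨by simp [Expr.eval], ?_⟩))
      fun he => ?_)) ?_ fun _ => id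
  · rw [Expr.eval_lt_eq_zero] at he
    simp [Expr.eval, hs₁.2.1, hs₁.1.1, hs₁.1.2, h.numVertices] at he
    omega
  · simp only [Expr.cost]
    omega
  · intro hpo
    have := hL.sum_degree_le hf hpo
    rw [h.sum_degree_eq] at this
    omega

theorem runs_infimaProgram_of_le (h : HoldsInput s₀ Γ f) (hf : IsSuccessorFn f)
    (hk : Γ.outputs.card = k) (hL : IsOrderedLabelling f k d L)
    (hle : s₀.arr 0 n ≤ n * k + n * k) :
    Runs infimaProgram s₀ (200 * (k + 1) * (s₀.arr 0 n + n) + 50 * (n * k + k + 1) + 200 * (n + 1))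
      (IsOutput k f) := by
  refine Runs.mono (.seq ((runs_tabulate h hf hk).mono le_rfl fun s₁ hs₁ => .ite
    (T := 200 * (k + 1) * (s₀.arr 0 n + n) + 50 * (n * k + k + 1) + 108 * n + 120)
    (fun he => ?_) fun _ => ?_)) ?_ fun _ => id
  · refine absurd (Expr.eval_lt_eq_zero.2 ?_) he
    simp [Expr.eval, hs₁.2.1, hs₁.1.1, hs₁.1.2, h.numVertices]
    omega
  · obtain ⟨hI₁, h4, h9, h8, h10⟩ := hs₁
    have h2 : s₁.reg 2 = k := (hI₁.1 2 (by simp)).trans (h.numOutputs.trans hk)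
    refine Runs.mono (.seq ((runs_clearRows h2 h4).mono le_rfl fun s₂ ⟨hr₂, ha₂, h7⟩ =>
      .seq ((runs_invert h hf (hI₁.trans ⟨fun x hx => hr₂ x (by omega),
        fun x hx => ha₂ x (by omega)⟩) (by rwa [ha₂ 8 (by simp)])).mono le_rfl
      fun s₃ ⟨hI₃, ha₃, hp, hp'⟩ => .seq ((runs_enqueueInitial h hL hI₃ hp hp').mono le_rfl
      fun s₄ ⟨hI₄, ha₄, hq, hdL⟩ => .seq ((runs_search h hf hk hL (invariant_empty hf hI₄
        ?_ ?_ ?_ ?_ hq hdL ?_)).mono le_rfl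
      fun s₅ ⟨H, hI₅, hH⟩ => .setReg (hI₅.isOutput h hf hL hH)))))) ?_ fun _ => id
    · simpa [ha₄ 8] using hp
    · simpa [ha₄ 8] using hp'
    · simpa [ha₄ 9, ha₃ 9, ha₂ 9] using h9
    · simpa [ha₄ 10, ha₃ 10, ha₂ 10] using h10
    · simpa [ha₄ 7, ha₃ 7] using h7
    · simp only [Expr.cost]
      omega
  · simp only [Expr.cost]
    omega

end Main

end RAM

/-- One algorithm, for all geometries and all successor functions. Register `0` of the final state
tells which kind of result is returned: `0` for "not a partial order", `1` for a system of infima.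
The summand `+ 1` in the running times matters only for the graph without vertices. -/
theorem mainTheorem5 :
    ∃ (P : RAM.Prog) (C : ℕ),
      ∀ (n k m : ℕ) (Γ : Geometry (Fin n)) (f : Γ.Fn),
        Geometry.IsSuccessorFn f → k = Γ.outputs.card → m = Γ.numEdges →
        ∀ s : RAM.State, RAM.HoldsInput s Γ f →
          ∃ (t : ℕ) (s' : RAM.State), RAM.Exec P s t s' ∧
            t ≤ C * (k ^ 2 * n + 1) ∧
            t ≤ C * (k * (m + n) + 1) ∧
            ((s'.reg 0 = 0 ∧ ¬ IsPartialOrder (Fin n) (Geometry.NaturalPreorder f)) ∨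
             (s'.reg 0 = 1 ∧ IsPartialOrder (Fin n) (Geometry.NaturalPreorder f) ∧
              (∀ v : Fin n, 1 ≤ RAM.outPath s' v ∧ RAM.outPath s' v ≤ k) ∧
              Geometry.IsPathLabelling f (RAM.outDist s') (RAM.outPath s') ∧
              IsSystemOfInfima (Geometry.NaturalPreorder f)
                (RAM.outDist s') (RAM.outPath s') (RAM.outInf k s') ∧
              IsPathInfima k (Geometry.NaturalPreorder f)
                (RAM.outDist s') (RAM.outPath s') (RAM.outInf k s'))) := by
  classical
  refine ⟨RAM.infimaProgram, 4000, ?_⟩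
  rintro n k m Γ f hf rfl rfl s h
  obtain ⟨d, L, hL⟩ := hf.exists_isOrderedLabelling
  set k := Γ.outputs.card with hk
  have hM : s.arr 0 n = 2 * Γ.numEdges := by rw [← h.sum_degree_eq, Geometry.sum_degree_eq]
  set m := Γ.numEdges
  have hkn : k ≤ n := by simpa using Γ.outputs.card_le_univ
  -- There is an output unless there are no vertices, so `n ≤ k * n` and `m ≤ k * m`.
  have hnk : n ≤ k * n := by
    rcases Nat.eq_zero_or_pos n with rfl | hn
    · simp
    · exact Nat.le_mul_of_pos_left n ((hL.pos ⟨0, hn⟩).trans (hL.le ⟨0, hn⟩))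
  have hnk' : k * n ≤ k ^ 2 * n := by
    rw [sq, mul_assoc]
    exact Nat.mul_le_mul_left k hnk
  have hmk : m ≤ k * m := by
    rcases Nat.eq_zero_or_pos n with rfl | hn
    · have : m = 0 := by
        rw [h.offset_zero] at hM
        omega
      simp [this]
    · exact Nat.le_mul_of_pos_left m ((hL.pos ⟨0, hn⟩).trans (hL.le ⟨0, hn⟩))
  rcases lt_or_ge (n * k + n * k) (s.arr 0 n) with hlt | hle
  · obtain ⟨t, s', hx, ht, hs'⟩ := RAM.runs_infimaProgram_of_lt h hf rfl hL hlt
    refine ⟨t, s', hx, by omega, ?_, hs'⟩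
    rw [mul_add k]
    omega
  · obtain ⟨t, s', hx, ht, hs'⟩ := RAM.runs_infimaProgram_of_le h hf rfl hL hle
    have h1 : t ≤ 2000 * (k * m + k * n + 1) := by
      refine ht.trans ?_
      rw [hM]
      nlinarith
    -- A graph that passes the test has `m ≤ n * k`.
    have h2 : k * m ≤ k ^ 2 * n := by
      rw [sq, mul_assoc]
      refine Nat.mul_le_mul_left k ?_
      rw [mul_comm n k] at hle
      omega
    refine ⟨t, s', hx, by omega, ?_, hs'⟩
    rw [mul_add k]
    omega
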